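/- Let $n_T,n_R\ge 1$, $N_m,N_e>0$, and let $(\mathbf H_m,\mathbf H_e)$ be random complex matrices of sizes $n_R\times n_T$ and $n_E\times n_T$ (with arbitrary joint distribution). For $\mathrm{SNR}=P/(n_RN_m)\ge 0$ let $$C_s(\mathrm{SNR})=\frac1{n_R}\,\mathbb E\Big\{\max_{\mathbf K\succeq 0,\ \operatorname{tr}\mathbf K\le P}\ \log\det\Big(\mathbf I+\frac1{N_m}\mathbf H_m\mathbf K\mathbf H_m^\dagger\Big)-\log\det\Big(\mathbf I+\frac1{N_e}\mathbf H_e\mathbf K\mathbf H_e^\dagger\Big)\Big\}$$ be the average secrecy capacity of the fading channel under the short-term power constraint (in nats per dimension). Put $\mathbf\Phi=\mathbf H_m^\dagger\mathbf H_m-\frac{N_m}{N_e}\mathbf H_e^\dagger\mathbf H_e$, let $\lambda_{\max}(\mathbf\Phi)$ be its largest eigenvalue and $l$ the multiplicity of that eigenvalue. Assume $\mathbb E\{[\lambda_{\max}(\mathbf\Phi)]^+\}<\infty$. Then the expectation defining $C_s(\mathrm{SNR})$ exists and is finite for every $\mathrm{SNR}\ge0$, and the (right) derivative of $C_s$ at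 $\mathrm{SNR}=0$ is $$\dot C_s(0)=\mathbb E\{[\lambda_{\max}(\mathbf\Phi)]^+\}.$$ If moreover the expectation on the right-hand side below is finite, then $C_s$ is differentiable at all sufficiently small $\mathrm{SNR}\ge 0$ (one-sidedly at $0$), and the (right) derivative at $0$ of its derivative is $$\ddot C_s(0)=-n_R\,\mathbb E\Big\{\min\ \sum_{i,j=1}^{l}\alpha_i\alpha_j\Big(|\mathbf u_j^\dagger\mathbf H_m^\dagger\mathbf H_m\mathbf u_i|^2-\frac{N_m^2}{N_e^2}|\mathbf u_j^\dagger\mathbf H_e^\dagger\mathbf H_e\mathbf u_i|^2\Big)\,1\{\lambda_{\max}(\mathbf\Phi)>0\}\Big\},$$ where, for each realization, the minimum is over the weights $\alpha_i\in[0,1]$ with $\sum_{i=1}^l\alpha_i=1$ and over the orthonormal bases $\{\mathbf u_i\}_{i=1}^l$ of the eigenspace of $\mathbf\Phi$ for $\lambda_{\max}(\mathbf\Phi)$. Under the same assumption the formula also holds with the minimum over $\{\alpha_i\}$ alone if, for each realization with $\lambda_{\max}(\mathbf\Phi)>0$, $\{\mathbf u_i\}$ is any fixed orthonormal basis of that eigenspace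 with $\mathbf u_j^\dagger\mathbf H_m^\dagger\mathbf H_m\mathbf u_i=0$ for $i\ne j$ (every orthonormal basis of it, if $l=1$). -/

import Mathlib

namespace SecrecyCapacity

open MeasureTheory Matrix Topology
open scoped ComplexOrder

noncomputable section

variable {nT nR nE : ℕ}

/-- The secrecy rate (in nats, not normalised by the number of receive antennas)
`log det (I + Nm⁻¹ Hm K Hm†) - log det (I + Ne⁻¹ He K He†)` of the input covariance matrix `K`.
Both determinants are real (and at least `1`) when `K` is positive semidefinite. -/
def rate (Nm Ne : ℝ) (Hm : Matrix (Fin nR) (Fin nT) ℂ) (He : Matrix (Fin nE) (Fin nT) ℂ)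
    (K : Matrix (Fin nT) (Fin nT) ℂ) : ℝ :=
  Real.log (1 + ((1 / Nm : ℝ) : ℂ) • (Hm * K * Hmᴴ)).det.re
    - Real.log (1 + ((1 / Ne : ℝ) : ℂ) • (He * K * Heᴴ)).det.re

/-- The maximum of the secrecy rate over all covariance matrices `K ⪰ 0` with `tr K ≤ P`.
For `0 ≤ P` the feasible set is non-empty and compact, so the supremum is a maximum. -/
def maxRate (Nm Ne : ℝ) (Hm : Matrix (Fin nR) (Fin nT) ℂ) (He : Matrix (Fin nE) (Fin nT) ℂ)
    (P : ℝ) : ℝ :=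
  sSup (rate Nm Ne Hm He '' {K | K.PosSemidef ∧ K.trace.re ≤ P})

/-- The secrecy capacity, in nats per dimension, of the channel with fixed matrices `Hm`, `He`,
as a function of `SNR = P / (nR Nm)`, that is with power `P = nR Nm SNR`. -/
def capacity (Nm Ne : ℝ) (Hm : Matrix (Fin nR) (Fin nT) ℂ) (He : Matrix (Fin nE) (Fin nT) ℂ)
    (snr : ℝ) : ℝ :=
  (1 / (nR : ℝ)) * maxRate Nm Ne Hm He (nR * Nm * snr)

/-- The average secrecy capacity of the fading channel under the short-term power constraint,
as a function of the signal-to-noise ratio. -/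
def avgCapacity {Ω : Type*} [MeasurableSpace Ω] (μ : Measure Ω) (Nm Ne : ℝ)
    (Hm : Ω → Matrix (Fin nR) (Fin nT) ℂ) (He : Ω → Matrix (Fin nE) (Fin nT) ℂ)
    (snr : ℝ) : ℝ :=
  ∫ ω, capacity Nm Ne (Hm ω) (He ω) snr ∂μ

/-- `Φ = Hm† Hm - (Nm / Ne) He† He`. -/
def Phi (Nm Ne : ℝ) (Hm : Matrix (Fin nR) (Fin nT) ℂ) (He : Matrix (Fin nE) (Fin nT) ℂ) :
    Matrix (Fin nT) (Fin nT) ℂ :=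
  Hmᴴ * Hm - ((Nm / Ne : ℝ) : ℂ) • (Heᴴ * He)

theorem phi_isHermitian (Nm Ne : ℝ) (Hm : Matrix (Fin nR) (Fin nT) ℂ)
    (He : Matrix (Fin nE) (Fin nT) ℂ) : (Phi Nm Ne Hm He).IsHermitian := by
  unfold Phi Matrix.IsHermitian
  rw [conjTranspose_sub, conjTranspose_smul, conjTranspose_mul, conjTranspose_mul,
    conjTranspose_conjTranspose, conjTranspose_conjTranspose]
  simp

/-- The largest eigenvalue of `Φ`. -/
def lambdaMax (Nm Ne : ℝ) (Hm : Matrix (Fin nR) (Fin nT) ℂ)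
    (He : Matrix (Fin nE) (Fin nT) ℂ) : ℝ :=
  ⨆ i, (phi_isHermitian Nm Ne Hm He).eigenvalues i

/-- The eigenspace of `Φ` for its largest eigenvalue. -/
def maxEigenspace (Nm Ne : ℝ) (Hm : Matrix (Fin nR) (Fin nT) ℂ)
    (He : Matrix (Fin nE) (Fin nT) ℂ) : Submodule ℂ (EuclideanSpace ℂ (Fin nT)) :=
  Module.End.eigenspace (Matrix.toEuclideanLin (Phi Nm Ne Hm He))
    ((lambdaMax Nm Ne Hm He : ℝ) : ℂ)

/-- The multiplicity `l` of the largest eigenvalue of `Φ`. -/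
def multiplicity (Nm Ne : ℝ) (Hm : Matrix (Fin nR) (Fin nT) ℂ)
    (He : Matrix (Fin nE) (Fin nT) ℂ) : ℕ :=
  Module.finrank ℂ (maxEigenspace Nm Ne Hm He)

/-- `u₁, …, u_l` is an orthonormal basis of the maximum-eigenvalue eigenspace of `Φ`. -/
def IsMaxEigenbasis (Nm Ne : ℝ) (Hm : Matrix (Fin nR) (Fin nT) ℂ)
    (He : Matrix (Fin nE) (Fin nT) ℂ)
    (u : Fin (multiplicity Nm Ne Hm He) → EuclideanSpace ℂ (Fin nT)) : Prop :=
  Orthonormal ℂ u ∧ Submodule.span ℂ (Set.range u) = maxEigenspace Nm Ne Hm He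

/-- `v† H† H w`. -/
def gramForm {m : ℕ} (H : Matrix (Fin m) (Fin nT) ℂ) (v w : EuclideanSpace ℂ (Fin nT)) : ℂ :=
  star v.ofLp ⬝ᵥ ((Hᴴ * H) *ᵥ w.ofLp)

/-- `∑ i j, α i α j (|u_j† Hm† Hm u_i|² - (Nm / Ne)² |u_j† He† He u_i|²)`. -/
def quadForm (Nm Ne : ℝ) (Hm : Matrix (Fin nR) (Fin nT) ℂ) (He : Matrix (Fin nE) (Fin nT) ℂ)
    {l : ℕ} (u : Fin l → EuclideanSpace ℂ (Fin nT)) (α : Fin l → ℝ) : ℝ :=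
  ∑ i, ∑ j, α i * α j *
    (‖gramForm Hm (u j) (u i)‖ ^ 2 - Nm ^ 2 / Ne ^ 2 * ‖gramForm He (u j) (u i)‖ ^ 2)

/-- The minimum of `quadForm` over the weights `α` (each in `[0, 1]`, with sum `1`),
for a given family `u`. -/
def minWeights (Nm Ne : ℝ) (Hm : Matrix (Fin nR) (Fin nT) ℂ)
    (He : Matrix (Fin nE) (Fin nT) ℂ) {l : ℕ} (u : Fin l → EuclideanSpace ℂ (Fin nT)) : ℝ :=
  sInf (quadForm Nm Ne Hm He u '' stdSimplex ℝ (Fin l))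

/-- The minimum of `quadForm` over the weights `α` and the orthonormal bases `u` of the
maximum-eigenvalue eigenspace, that is over all covariance directions
`∑ i, α i u_i u_i†` that transmit in this eigenspace. -/
def minWeightsBases (Nm Ne : ℝ) (Hm : Matrix (Fin nR) (Fin nT) ℂ)
    (He : Matrix (Fin nE) (Fin nT) ℂ) : ℝ :=
  sInf {x | ∃ u, IsMaxEigenbasis Nm Ne Hm He u ∧
    ∃ α ∈ stdSimplex ℝ (Fin (multiplicity Nm Ne Hm He)), x = quadForm Nm Ne Hm He u α}

/-- `d` is the second derivative of `f` at `x` relative to `S` (one-sided if `S` is a half-line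
that begins at `x`): `f` is differentiable at the points of `S` near `x`, and its derivative has
the derivative `d` at `x`. -/
def HasSecondDerivWithinAt (f : ℝ → ℝ) (d : ℝ) (S : Set ℝ) (x : ℝ) : Prop :=
  (∀ᶠ s in 𝓝[S] x, DifferentiableWithinAt ℝ f S s) ∧
    HasDerivWithinAt (derivWithin f S) d S x

end

end SecrecyCapacity

/-! Fix a realization. Dividing the covariance by `Nm` and scaling `He` by √(Nm/Ne) to a matrix G
makes both noises unit. With H = `Hm`, the capacity is then, up to factors nR, g(t) = max over tr K
≤ t of log det(1 + HKH†) − log det(1 + GKG†). Let L = λ_max⁺, and let q be the claimed minimum, or 0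
if λ_max ≤ 0. Then L t − q t²/2 ≤ g(t) ≤ L t for all t ≥ 0, and for every ε > 0, g(t) ≤ L t − (q −
ε) t²/2 for small t > 0.

These bounds must become statements about derivatives and pass through the expectation, using only
the integrability of L and q. Concavity of g does both. The secant over [t, 2t] gives L − 2qt ≤
g'(t) ≤ L, so (g'(t) − L)/t is dominated by 2q. Secants of length ηt turn the expansion of g into
g'(t) = L − qt + o(t). Dominated convergence then yields both derivatives.

Concavity of g is not evident, because the rate need not be concave in K. It comes from channel
enhancement. For S ≻ 0 some channel better than both H and G has a secrecy rate at S that H already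
attains at some K ⪯ S (`exists_enhanced`). The secrecy rate of the better channel is a log det of an
error covariance, hence concave in S (`logDet_errCov_concave`).

The lower bound on g uses directions Q supported on the top eigenspace of Φ, where H†HQ = G†GQ +
λ_max Q (`sub_curvature_le_nrate`). The upper expansion is a compactness argument over all
directions (`exists_uniform_expansion`): only those in that eigenspace reach the slope λ_max. In a
basis of the eigenspace that diagonalizes H†H, deleting the off-diagonal entries of Q does not
increase the quadratic term, so weights alone suffice (`exists_quadForm_le_curvature`). -/

noncomputable section

open MeasureTheory Matrix Topology Filter
open scoped ComplexOrder

set_option linter.unusedSectionVars false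

namespace SecrecyCapacity

/-! ### Trace bounds and monotonicity of log det -/

section LogDet

variable {n m : Type*} [Fintype n] [DecidableEq n] [Fintype m] [DecidableEq m]

/-- The logarithm of the (real part of the) determinant. -/
def logDet (X : Matrix n n ℂ) : ℝ := Real.log X.det.re

theorem det_re_pos {X : Matrix n n ℂ} (hX : X.PosDef) : 0 < X.det.re :=
  (Complex.pos_iff.1 hX.det_pos).1

theorem det_eq_re {X : Matrix n n ℂ} (hX : X.PosDef) : X.det = (X.det.re : ℂ) := by
  apply Complex.ext
  · simp
  · simpa using (Complex.pos_iff.1 hX.det_pos).2.symm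

theorem exists_unitary_diagonal {X : Matrix n n ℂ} (hX : X.IsHermitian) :
    ∃ U : Matrix n n ℂ, Uᴴ * U = 1 ∧ U * Uᴴ = 1 ∧
      X = U * diagonal (fun i => (hX.eigenvalues i : ℂ)) * Uᴴ := by
  refine ⟨hX.eigenvectorUnitary, ?_, ?_, ?_⟩
  · exact Unitary.coe_star_mul_self hX.eigenvectorUnitary
  · exact Unitary.coe_mul_star_self hX.eigenvectorUnitary
  · exact hX.spectral_theorem

theorem trace_conj_unitary {U : Matrix n n ℂ} (hU : Uᴴ * U = 1) (D : Matrix n n ℂ) :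
    (U * D * Uᴴ).trace = D.trace := by
  rw [trace_mul_comm, ← Matrix.mul_assoc, hU, Matrix.one_mul]

theorem det_conj_unitary {U : Matrix n n ℂ} (hU : Uᴴ * U = 1) (D : Matrix n n ℂ) :
    (U * D * Uᴴ).det = D.det := by
  rw [det_mul_comm, ← Matrix.mul_assoc, hU, Matrix.one_mul]

theorem det_one_add_smul_eq_prod {X : Matrix n n ℂ} (hX : X.IsHermitian) (s : ℝ) :
    (1 + s • X).det = ((∏ i, (1 + s * hX.eigenvalues i) : ℝ) : ℂ) := by
  obtain ⟨U, hU, hU', h⟩ := exists_unitary_diagonal hX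
  have : 1 + s • X = U * (diagonal fun i => ((1 + s * hX.eigenvalues i : ℝ) : ℂ)) * Uᴴ := by
    have h2 : (diagonal fun i => ((1 + s * hX.eigenvalues i : ℝ) : ℂ))
        = 1 + s • diagonal (fun i => (hX.eigenvalues i : ℂ)) := by
      rw [← diagonal_one, ← diagonal_smul, diagonal_add]; simp
    rw [h2, Matrix.mul_add, Matrix.add_mul, Matrix.mul_one, hU', Matrix.mul_smul,
      Matrix.smul_mul, ← h]
  rw [this, det_conj_unitary hU, det_diagonal]
  push_cast; rfl

theorem det_one_add_eq_prod {X : Matrix n n ℂ} (hX : X.IsHermitian) :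
    (1 + X).det = ((∏ i, (1 + hX.eigenvalues i) : ℝ) : ℂ) := by
  simpa using det_one_add_smul_eq_prod hX 1

theorem trace_mul_self_eq_sum {X : Matrix n n ℂ} (hX : X.IsHermitian) :
    (X * X).trace = ((∑ i, hX.eigenvalues i ^ 2 : ℝ) : ℂ) := by
  obtain ⟨U, hU, hU', h⟩ := exists_unitary_diagonal hX
  set D := diagonal (fun i => (hX.eigenvalues i : ℂ)) with hD
  have : X * X = U * (D * D) * Uᴴ := by
    calc X * X = U * D * Uᴴ * (U * D * Uᴴ) := by rw [← h]
      _ = U * D * (Uᴴ * U) * D * Uᴴ := by simp only [Matrix.mul_assoc]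
      _ = _ := by rw [hU]; simp only [Matrix.mul_assoc, Matrix.mul_one]
  rw [this, trace_conj_unitary hU, hD, diagonal_mul_diagonal, trace_diagonal]
  push_cast; simp [sq]

theorem trace_re_eq_sum {X : Matrix n n ℂ} (hX : X.IsHermitian) :
    X.trace.re = ∑ i, hX.eigenvalues i := by
  rw [hX.trace_eq_sum_eigenvalues]; simp

theorem trace_mul_self_re_eq_sum {X : Matrix n n ℂ} (hX : X.IsHermitian) :
    (X * X).trace.re = ∑ i, hX.eigenvalues i ^ 2 := by
  rw [trace_mul_self_eq_sum hX, Complex.ofReal_re]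

theorem logDet_one_add_eq_sum {X : Matrix n n ℂ} (hX : X.PosSemidef) :
    logDet (1 + X) = ∑ i, Real.log (1 + hX.1.eigenvalues i) := by
  rw [logDet, det_one_add_eq_prod hX.1, Complex.ofReal_re, Real.log_prod]
  intro i _
  have := hX.eigenvalues_nonneg i
  positivity

theorem trace_re_nonneg {X : Matrix n n ℂ} (hX : X.PosSemidef) : 0 ≤ X.trace.re :=
  (Complex.nonneg_iff.1 hX.trace_nonneg).1

theorem differentiableAt_logDet_one_add_smul {X : Matrix n n ℂ} (hX : X.PosSemidef) {s : ℝ}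
    (hs : 0 ≤ s) : DifferentiableAt ℝ (fun s : ℝ => logDet (1 + s • X)) s := by
  simp only [logDet, det_one_add_smul_eq_prod hX.1, Complex.ofReal_re]
  refine DifferentiableAt.log (by fun_prop) (Finset.prod_ne_zero_iff.2 fun i _ => ?_)
  have := hX.eigenvalues_nonneg i
  positivity

theorem log_one_add_le_cubic {x : ℝ} (hx : 0 ≤ x) :
    Real.log (1 + x) ≤ x - x ^ 2 / 2 + x ^ 3 / 3 := by
  let f : ℝ → ℝ := fun x => x - x ^ 2 / 2 + x ^ 3 / 3 - Real.log (1 + x)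
  have hd : ∀ y ∈ interior (Set.Ici (0:ℝ)), HasDerivWithinAt f (y ^ 3 / (1 + y))
      (interior (Set.Ici 0)) y := by
    intro y hy
    rw [interior_Ici, Set.mem_Ioi] at hy
    have h1 : (1 + y) ≠ 0 := by positivity
    have := ((((hasDerivAt_id y).sub (((hasDerivAt_id y).pow 2).div_const 2)).add
      (((hasDerivAt_id y).pow 3).div_const 3)).sub (((hasDerivAt_id y).const_add 1).log h1))
    refine (HasDerivAt.congr_deriv this ?_).hasDerivWithinAt
    simp; field_simp; ring
  have hc : ContinuousOn f (Set.Ici 0) := by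
    apply ContinuousOn.sub
    · fun_prop
    · apply ContinuousOn.log (by fun_prop)
      intro y hy; simp at hy; positivity
  have := (monotoneOn_of_hasDerivWithinAt_nonneg (convex_Ici 0) hc hd (by
    intro y hy; rw [interior_Ici, Set.mem_Ioi] at hy; positivity)) (Set.self_mem_Ici) hx hx
  simp [f] at this
  linarith

theorem quadratic_le_log_one_add {x : ℝ} (hx : 0 ≤ x) :
    x - x ^ 2 / 2 ≤ Real.log (1 + x) := by
  let f : ℝ → ℝ := fun x => Real.log (1 + x) - (x - x ^ 2 / 2)
  have hd : ∀ y ∈ interior (Set.Ici (0:ℝ)), HasDerivWithinAt f (y ^ 2 / (1 + y))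
      (interior (Set.Ici 0)) y := by
    intro y hy
    rw [interior_Ici, Set.mem_Ioi] at hy
    have h1 : (1 + y) ≠ 0 := by positivity
    have := (((hasDerivAt_id y).const_add 1).log h1).sub ((hasDerivAt_id y).sub
      (((hasDerivAt_id y).pow 2).div_const 2))
    refine (HasDerivAt.congr_deriv this ?_).hasDerivWithinAt
    simp; field_simp; ring
  have hc : ContinuousOn f (Set.Ici 0) := by
    apply ContinuousOn.sub
    · apply ContinuousOn.log (by fun_prop)
      intro y hy; simp at hy; positivity
    · fun_prop
  have := (monotoneOn_of_hasDerivWithinAt_nonneg (convex_Ici 0) hc hd (by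
    intro y hy; rw [interior_Ici, Set.mem_Ioi] at hy; positivity)) (Set.self_mem_Ici) hx hx
  simp [f] at this
  linarith

theorem logDet_one_add_le_trace {X : Matrix n n ℂ} (hX : X.PosSemidef) :
    logDet (1 + X) ≤ X.trace.re := by
  rw [logDet_one_add_eq_sum hX, trace_re_eq_sum hX.1]
  refine Finset.sum_le_sum fun i _ => ?_
  have h := hX.eigenvalues_nonneg i
  have := Real.log_le_sub_one_of_pos (x := 1 + hX.1.eigenvalues i) (by positivity)
  linarith

theorem trace_sub_le_logDet_one_add {X : Matrix n n ℂ} (hX : X.PosSemidef) :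
    X.trace.re - (X * X).trace.re / 2 ≤ logDet (1 + X) := by
  rw [logDet_one_add_eq_sum hX, trace_re_eq_sum hX.1, trace_mul_self_re_eq_sum hX.1,
    Finset.sum_div, ← Finset.sum_sub_distrib]
  exact Finset.sum_le_sum fun i _ => quadratic_le_log_one_add (hX.eigenvalues_nonneg i)

theorem trace_mul_self_le {X : Matrix n n ℂ} (hX : X.PosSemidef) :
    (X * X).trace.re ≤ X.trace.re ^ 2 := by
  rw [trace_re_eq_sum hX.1, trace_mul_self_re_eq_sum hX.1]
  exact Finset.sum_sq_le_sq_sum_of_nonneg fun i _ => hX.eigenvalues_nonneg i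

/-- The scalar cubic bound is summed over the eigenvalues; the sum of their cubes is at most the
cube of their sum since they are nonnegative. -/
theorem logDet_one_add_le_cubic {X : Matrix n n ℂ} (hX : X.PosSemidef) :
    logDet (1 + X) ≤ X.trace.re - (X * X).trace.re / 2 + X.trace.re ^ 3 / 3 := by
  have h3 : ∑ i, hX.1.eigenvalues i ^ 3 ≤ (∑ i, hX.1.eigenvalues i) ^ 3 := by
    have h0 := hX.eigenvalues_nonneg
    calc ∑ i, hX.1.eigenvalues i ^ 3
        ≤ ∑ i, hX.1.eigenvalues i * (∑ j, hX.1.eigenvalues j) ^ 2 := by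
          refine Finset.sum_le_sum fun i _ => ?_
          rw [pow_succ']
          refine mul_le_mul_of_nonneg_left ?_ (h0 i)
          exact pow_le_pow_left₀ (h0 i)
            (Finset.single_le_sum (fun j _ => h0 j) (Finset.mem_univ i)) 2
      _ = _ := by rw [← Finset.sum_mul]; ring
  refine le_trans ?_ (add_le_add le_rfl (div_le_div_of_nonneg_right
    (trace_re_eq_sum hX.1 ▸ h3) (by norm_num : (0:ℝ) ≤ 3)))
  rw [logDet_one_add_eq_sum hX, trace_re_eq_sum hX.1, trace_mul_self_re_eq_sum hX.1,
    Finset.sum_div, Finset.sum_div, ← Finset.sum_sub_distrib, ← Finset.sum_add_distrib]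
  exact Finset.sum_le_sum fun i _ => log_one_add_le_cubic (hX.eigenvalues_nonneg i)

theorem logDet_le_trace_sub_card {X : Matrix n n ℂ} (hX : X.PosDef) :
    logDet X ≤ X.trace.re - Fintype.card n := by
  rw [logDet, hX.1.det_eq_prod_eigenvalues, trace_re_eq_sum hX.1]
  have : (∏ i, (hX.1.eigenvalues i : ℂ)) = ((∏ i, hX.1.eigenvalues i : ℝ) : ℂ) := by
    push_cast; rfl
  erw [this]
  rw [Complex.ofReal_re, Real.log_prod fun i _ => (hX.eigenvalues_pos i).ne']
  calc _ ≤ ∑ i, (hX.1.eigenvalues i - 1) :=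
        Finset.sum_le_sum fun i _ => Real.log_le_sub_one_of_pos (hX.eigenvalues_pos i)
    _ = _ := by simp

theorem exists_eq_conjTranspose_mul_self {X : Matrix n n ℂ} (hX : X.PosSemidef) :
    ∃ D : Matrix n n ℂ, D.IsHermitian ∧ X = Dᴴ * D := by
  obtain ⟨U, hU, hU', h⟩ := exists_unitary_diagonal hX.1
  set S : Matrix n n ℂ := diagonal (fun i => (Real.sqrt (hX.1.eigenvalues i) : ℂ)) with hS
  have hS1 : Sᴴ = S := by
    rw [hS, diagonal_conjTranspose]; congr 1; ext i; simp
  have hS2 : S * S = diagonal (fun i => (hX.1.eigenvalues i : ℂ)) := by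
    rw [hS, diagonal_mul_diagonal]; congr 1; ext i
    rw [← Complex.ofReal_mul, Real.mul_self_sqrt (hX.eigenvalues_nonneg i)]
  have hH : (U * S * Uᴴ)ᴴ = U * S * Uᴴ := by
    simp only [conjTranspose_mul, conjTranspose_conjTranspose, hS1, Matrix.mul_assoc]
  refine ⟨U * S * Uᴴ, hH, ?_⟩
  rw [hH]
  calc X = U * (S * S) * Uᴴ := by rw [hS2, ← h]
    _ = U * S * 1 * S * Uᴴ := by simp only [Matrix.mul_assoc, Matrix.mul_one]
    _ = _ := by rw [← hU]; simp only [Matrix.mul_assoc]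

theorem trace_mul_re_nonneg {X Y : Matrix n n ℂ} (hX : X.PosSemidef) (hY : Y.PosSemidef) :
    0 ≤ (X * Y).trace.re := by
  obtain ⟨D, -, rfl⟩ := exists_eq_conjTranspose_mul_self hX
  rw [Matrix.mul_assoc, trace_mul_comm]
  exact trace_re_nonneg (hY.mul_mul_conjTranspose_same D)

/-- The tangent inequality that expresses concavity of log det. Writing Y⁻¹ = D†D reduces it to log
λ ≤ λ − 1 on the eigenvalues of D X D†. -/
theorem logDet_le_add_trace {X Y : Matrix n n ℂ} (hX : X.PosDef) (hY : Y.PosDef) :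
    logDet X ≤ logDet Y + ((Y⁻¹ * X).trace.re - Fintype.card n) := by
  obtain ⟨D, hD, hYD⟩ := exists_eq_conjTranspose_mul_self hY.inv.posSemidef
  have hu : IsUnit D := by
    have : IsUnit (Dᴴ * D) := hYD ▸ hY.inv.isUnit
    rw [isUnit_iff_isUnit_det, det_mul] at this
    rw [isUnit_iff_isUnit_det]
    exact isUnit_of_mul_isUnit_right this
  have hZ : (D * X * Dᴴ).PosDef := by
    have := (Matrix.IsUnit.posDef_star_right_conjugate_iff (x := X) hu).2 hX
    simpa [star_eq_conjTranspose] using this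
  have h1 := logDet_le_trace_sub_card hZ
  have h2 : (D * X * Dᴴ).trace = (Y⁻¹ * X).trace := by
    rw [hYD, Matrix.mul_assoc, trace_mul_comm, Matrix.mul_assoc, trace_mul_comm]
  have h3 : (D * X * Dᴴ).det * Y.det = X.det := by
    have : Y⁻¹.det * Y.det = 1 := by
      rw [← det_mul, nonsing_inv_mul _ ((isUnit_iff_isUnit_det _).1 hY.isUnit), det_one]
    rw [hYD, det_mul] at this
    rw [det_mul, det_mul]
    linear_combination X.det * this
  have h4 : logDet X = logDet (D * X * Dᴴ) + logDet Y := by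
    rw [logDet, logDet, logDet, ← Real.log_mul (det_re_pos hZ).ne' (det_re_pos hY).ne', ← h3,
      det_eq_re hZ, det_eq_re hY, ← Complex.ofReal_mul]
    simp
  rw [h4, ← h2]; linarith

theorem logDet_mono {X Y : Matrix n n ℂ} (hX : X.PosDef) (h : (Y - X).PosSemidef) :
    logDet X ≤ logDet Y := by
  have hY : Y.PosDef := by simpa using hX.add_posSemidef h
  have h1 := logDet_le_add_trace hX hY
  have h2 := trace_mul_re_nonneg hY.inv.posSemidef h
  rw [Matrix.mul_sub, nonsing_inv_mul _ ((isUnit_iff_isUnit_det _).1 hY.isUnit), trace_sub,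
    trace_one] at h2
  simp at h2
  linarith

theorem posDef_one_add {X : Matrix n n ℂ} (hX : X.PosSemidef) : (1 + X).PosDef :=
  PosDef.one.add_posSemidef hX

end LogDet

/-! ### Linear estimation and concavity of the error covariance -/

section ErrorCov

variable {n m p : Type*} [Fintype n] [DecidableEq n] [Fintype m] [DecidableEq m]
  [Fintype p] [DecidableEq p]

/-- The error covariance of the linear estimate of a vector with covariance `S` from its image
under `G` in white noise. -/
def errCov (G : Matrix m n ℂ) (S : Matrix n n ℂ) : Matrix n n ℂ :=
  S - S * Gᴴ * (1 + G * S * Gᴴ)⁻¹ * G * S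

theorem posDef_one_add_conj (G : Matrix m n ℂ) {S : Matrix n n ℂ} (hS : S.PosSemidef) :
    (1 + G * S * Gᴴ).PosDef :=
  posDef_one_add (hS.mul_mul_conjTranspose_same G)

theorem inv_mul_of_posDef {X : Matrix n n ℂ} (hX : X.PosDef) : X⁻¹ * X = 1 :=
  nonsing_inv_mul _ ((isUnit_iff_isUnit_det _).1 hX.isUnit)

theorem mul_inv_of_posDef {X : Matrix n n ℂ} (hX : X.PosDef) : X * X⁻¹ = 1 :=
  mul_nonsing_inv _ ((isUnit_iff_isUnit_det _).1 hX.isUnit)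

/-- For invertible S this says that the error covariance is (S⁻¹ + G†G)⁻¹; the product form also
covers singular S. -/
theorem errCov_mul (G : Matrix m n ℂ) {S : Matrix n n ℂ} (hS : S.PosSemidef) :
    errCov G S * (1 + Gᴴ * G * S) = S := by
  have h := inv_mul_of_posDef (posDef_one_add_conj G hS)
  rw [errCov]
  generalize (1 + G * S * Gᴴ)⁻¹ = J at h ⊢
  have h1 : J * (G * (S * (Gᴴ * (G * S)))) = G * S - J * (G * S) := by
    calc J * (G * (S * (Gᴴ * (G * S)))) = (J * (1 + G * S * Gᴴ)) * (G * S) - J * (G * S) := by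
          simp only [Matrix.mul_add, Matrix.add_mul, Matrix.mul_assoc, Matrix.mul_one]; abel
      _ = _ := by rw [h, Matrix.one_mul]
  simp only [Matrix.mul_add, Matrix.sub_mul, Matrix.mul_assoc, Matrix.mul_one, h1, Matrix.mul_sub]
  abel

/-- The error covariance of the linear estimator `L`. -/
def linErrCov (G : Matrix m n ℂ) (L : Matrix n m ℂ) (S : Matrix n n ℂ) : Matrix n n ℂ :=
  (1 - L * G) * S * (1 - L * G)ᴴ + L * Lᴴ

/-- Completion of the square in L. It exhibits `errCov` as the least of the matrices `linErrCov G L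
S`, each affine in S, which is the source of its concavity. -/
theorem linErrCov_eq (G : Matrix m n ℂ) (L : Matrix n m ℂ) {S : Matrix n n ℂ}
    (hS : S.PosSemidef) :
    linErrCov G L S = errCov G S + (L - S * Gᴴ * (1 + G * S * Gᴴ)⁻¹) * (1 + G * S * Gᴴ) *
      (L - S * Gᴴ * (1 + G * S * Gᴴ)⁻¹)ᴴ := by
  have h := inv_mul_of_posDef (posDef_one_add_conj G hS)
  have h' := mul_inv_of_posDef (posDef_one_add_conj G hS)
  have hJ : ((1 + G * S * Gᴴ)⁻¹)ᴴ = (1 + G * S * Gᴴ)⁻¹ := (posDef_one_add_conj G hS).inv.1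
  have hSH : Sᴴ = S := hS.1
  have hT : L * (1 + G * S * Gᴴ) * Lᴴ = L * Lᴴ + L * G * S * Gᴴ * Lᴴ := by
    simp only [Matrix.mul_add, Matrix.add_mul, Matrix.mul_assoc, Matrix.one_mul]
  rw [errCov]
  set T := 1 + G * S * Gᴴ
  have h1 : ∀ X : Matrix m n ℂ, T⁻¹ * (T * X) = X := fun X => by
    rw [← Matrix.mul_assoc, h, Matrix.one_mul]
  have h2 : ∀ X : Matrix m n ℂ, T * (T⁻¹ * X) = X := fun X => by
    rw [← Matrix.mul_assoc, h', Matrix.one_mul]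
  simp only [linErrCov, conjTranspose_sub, conjTranspose_mul, conjTranspose_one, hJ, hSH,
    conjTranspose_conjTranspose, Matrix.mul_sub, Matrix.sub_mul, Matrix.mul_assoc, Matrix.one_mul,
    Matrix.mul_one, h1, h2] at hT ⊢
  rw [hT]
  abel

theorem posSemidef_linErrCov_sub (G : Matrix m n ℂ) (L : Matrix n m ℂ) {S : Matrix n n ℂ}
    (hS : S.PosSemidef) : (linErrCov G L S - errCov G S).PosSemidef := by
  rw [linErrCov_eq G L hS, add_sub_cancel_left]
  exact (posDef_one_add_conj G hS).posSemidef.mul_mul_conjTranspose_same _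

theorem linErrCov_opt (G : Matrix m n ℂ) {S : Matrix n n ℂ} (hS : S.PosSemidef) :
    linErrCov G (S * Gᴴ * (1 + G * S * Gᴴ)⁻¹) S = errCov G S := by
  rw [linErrCov_eq G _ hS]; simp

theorem posSemidef_errCov (G : Matrix m n ℂ) {S : Matrix n n ℂ} (hS : S.PosSemidef) :
    (errCov G S).PosSemidef := by
  rw [← linErrCov_opt G hS, linErrCov]
  exact (hS.mul_mul_conjTranspose_same _).add (posSemidef_self_mul_conjTranspose _)

theorem posSemidef_sub_errCov (G : Matrix m n ℂ) {S : Matrix n n ℂ} (hS : S.PosSemidef) :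
    (S - errCov G S).PosSemidef := by
  simpa [linErrCov] using posSemidef_linErrCov_sub G 0 hS

theorem linErrCov_comb (G : Matrix m n ℂ) (L : Matrix n m ℂ) (S₁ S₂ : Matrix n n ℂ) {a b : ℝ}
    (hab : a + b = 1) :
    linErrCov G L (a • S₁ + b • S₂) = a • linErrCov G L S₁ + b • linErrCov G L S₂ := by
  have : L * Lᴴ = a • (L * Lᴴ) + b • (L * Lᴴ) := by rw [← add_smul, hab, one_smul]
  rw [linErrCov]
  nth_rw 1 [this]
  simp only [linErrCov, Matrix.mul_add, Matrix.add_mul, Matrix.mul_smul, Matrix.smul_mul, smul_add]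
  abel

/-- The difference is a conjugate of 1 − (1 + X)⁻¹ with X = G S G† ⪰ 0. Being an inequality and not
an expansion, it gives a quadratic lower bound on the rate at every power. -/
theorem posSemidef_errCov_sub (G : Matrix m n ℂ) {S : Matrix n n ℂ} (hS : S.PosSemidef) :
    (errCov G S - (S - S * Gᴴ * G * S)).PosSemidef := by
  have hX := hS.mul_mul_conjTranspose_same G
  have h := inv_mul_of_posDef (posDef_one_add_conj G hS)
  have h' := mul_inv_of_posDef (posDef_one_add_conj G hS)
  have hJ : ((1 + G * S * Gᴴ)⁻¹)ᴴ = (1 + G * S * Gᴴ)⁻¹ := (posDef_one_add_conj G hS).inv.1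
  have hSH : Sᴴ = S := hS.1
  rw [errCov]
  set X := G * S * Gᴴ
  set J := (1 + X)⁻¹
  have hXH : Xᴴ = X := hX.1
  have key : 1 - J = J * X * Jᴴ + (J * X) * (J * X)ᴴ := by
    have e : J * (1 + X) * (1 + X) * J = 1 := by
      rw [h, Matrix.one_mul, h']
    have e2 : J * (1 + X) * J = J := by rw [h, Matrix.one_mul]
    rw [conjTranspose_mul, hJ, hXH]
    calc 1 - J = J * (1 + X) * (1 + X) * J - J * (1 + X) * J := by rw [e, e2]
      _ = _ := by noncomm_ring
  have : S - S * Gᴴ * J * G * S - (S - S * Gᴴ * G * S) = (S * Gᴴ) * (1 - J) * (S * Gᴴ)ᴴ := by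
    rw [conjTranspose_mul, conjTranspose_conjTranspose, hSH]
    simp only [Matrix.mul_sub, Matrix.sub_mul, Matrix.mul_assoc, Matrix.mul_one]
    abel
  rw [this, key]
  exact ((hX.mul_mul_conjTranspose_same J).add
    (posSemidef_self_mul_conjTranspose _)).mul_mul_conjTranspose_same _

/-- The chain rule of mutual information for the stacked channel (G, D): after G has been observed,
D sees an input with the error covariance. -/
theorem det_one_add_add_mul (G : Matrix m n ℂ) (D : Matrix p n ℂ) {S : Matrix n n ℂ}
    (hS : S.PosSemidef) :
    (1 + (Gᴴ * G + Dᴴ * D) * S).det =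
      (1 + D * errCov G S * Dᴴ).det * (1 + G * S * Gᴴ).det := by
  have h := errCov_mul G hS
  have h1 : 1 + (Gᴴ * G + Dᴴ * D) * S
      = (1 + Dᴴ * (D * errCov G S)) * (1 + Gᴴ * G * S) := by
    rw [Matrix.add_mul _ _ (1 + Gᴴ * G * S), Matrix.mul_assoc Dᴴ, Matrix.mul_assoc D, h,
      Matrix.one_mul, Matrix.add_mul, Matrix.mul_assoc Dᴴ D S]
    abel
  have h2 : (1 + Gᴴ * G * S).det = (1 + G * S * Gᴴ).det := by
    rw [Matrix.mul_assoc, det_one_add_mul_comm]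
  rw [h1, det_mul, det_one_add_mul_comm, h2]

theorem logDet_errCov_concave (G : Matrix m n ℂ) (D : Matrix p n ℂ) {S₁ S₂ : Matrix n n ℂ}
    (h₁ : S₁.PosSemidef) (h₂ : S₂.PosSemidef) {a b : ℝ} (ha : 0 ≤ a) (hb : 0 ≤ b)
    (hab : a + b = 1) :
    a * logDet (1 + D * errCov G S₁ * Dᴴ) + b * logDet (1 + D * errCov G S₂ * Dᴴ) ≤
      logDet (1 + D * errCov G (a • S₁ + b • S₂) * Dᴴ) := by
  set S := a • S₁ + b • S₂ with hSdef
  have hS : S.PosSemidef := (h₁.smul ha).add (h₂.smul hb)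
  -- The estimator that is optimal for the mixture is applied to both endpoints. There it can only
  -- overestimate the error, and its error covariance is affine.
  set L := S * Gᴴ * (1 + G * S * Gᴴ)⁻¹ with hL
  have hY := posDef_one_add_conj D (posSemidef_errCov G hS)
  set Y := 1 + D * errCov G S * Dᴴ with hYdef
  have bound : ∀ T : Matrix n n ℂ, T.PosSemidef →
      logDet (1 + D * errCov G T * Dᴴ) ≤ logDet Y +
        ((Y⁻¹ * (1 + D * linErrCov G L T * Dᴴ)).trace.re - Fintype.card p) := by
    intro T hT
    refine (logDet_le_add_trace (posDef_one_add_conj D (posSemidef_errCov G hT)) hY).trans ?_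
    have := trace_mul_re_nonneg hY.inv.posSemidef
      ((posSemidef_linErrCov_sub G L hT).mul_mul_conjTranspose_same D)
    rw [Matrix.mul_sub, Matrix.sub_mul, Matrix.mul_sub, trace_sub, Complex.sub_re] at this
    rw [Matrix.mul_add, Matrix.mul_add, trace_add, trace_add, Complex.add_re, Complex.add_re]
    linarith
  have b1 := mul_le_mul_of_nonneg_left (bound S₁ h₁) ha
  have b2 := mul_le_mul_of_nonneg_left (bound S₂ h₂) hb
  -- The linear terms average to tr(Y⁻¹Y), which cancels the dimension in the tangent inequality.
  have e : a * (Y⁻¹ * (1 + D * linErrCov G L S₁ * Dᴴ)).trace.re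
      + b * (Y⁻¹ * (1 + D * linErrCov G L S₂ * Dᴴ)).trace.re = Fintype.card p := by
    have h3 : Y = a • (1 + D * linErrCov G L S₁ * Dᴴ) + b • (1 + D * linErrCov G L S₂ * Dᴴ) := by
      have h1 : (1 : Matrix p p ℂ) = a • 1 + b • 1 := by rw [← add_smul, hab, one_smul]
      have h4 := linErrCov_comb G L S₁ S₂ hab
      rw [← hSdef, hL, linErrCov_opt G hS, ← hL] at h4
      rw [hYdef, h4]
      nth_rw 1 [h1]
      simp only [Matrix.mul_add, Matrix.add_mul, Matrix.mul_smul, Matrix.smul_mul, smul_add]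
      abel
    have h5 := congrArg (fun Z => (Y⁻¹ * Z).trace.re) h3
    simp only [inv_mul_of_posDef hY, Matrix.mul_add _ (a • _) (b • _), Matrix.mul_smul, trace_add,
      trace_smul, Complex.add_re, Complex.smul_re, smul_eq_mul, trace_one] at h5
    rw [← h5]; simp
  have e2 : logDet Y = a * logDet Y + b * logDet Y := by rw [← add_mul, hab, one_mul]
  have e3 : a * (Fintype.card p : ℝ) + b * Fintype.card p = Fintype.card p := by
    rw [← add_mul, hab, one_mul]
  nlinarith

end ErrorCov

/-! ### Channel enhancement -/

section Enhanced

variable {n m p : Type*} [Fintype n] [DecidableEq n] [Fintype m] [DecidableEq m]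
  [Fintype p] [DecidableEq p]

theorem det_one_add_conj (G : Matrix m n ℂ) (K : Matrix n n ℂ) :
    (1 + G * K * Gᴴ).det = (1 + Gᴴ * G * K).det := by
  rw [det_one_add_mul_comm, Matrix.mul_assoc]

theorem logDet_eq_add_of_det_eq {X : Matrix n n ℂ} {Y : Matrix m m ℂ} {Z : Matrix p p ℂ}
    (hY : Y.PosDef) (hZ : Z.PosDef) (h : X.det = Y.det * Z.det) :
    logDet X = logDet Y + logDet Z := by
  rw [logDet, logDet, logDet, ← Real.log_mul (det_re_pos hY).ne' (det_re_pos hZ).ne', h,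
    det_eq_re hY, det_eq_re hZ, ← Complex.ofReal_mul]
  simp

/-- With N = R†R and R Hermitian, the eigenvectors of R⁻¹ M R⁻¹ diagonalize both forms. -/
theorem exists_simultaneous_diagonal {M N : Matrix n n ℂ} (hM : M.IsHermitian) (hN : N.PosDef) :
    ∃ (C W : Matrix n n ℂ) (d : n → ℝ), C * W = 1 ∧ W * C = 1 ∧ N = Wᴴ * W ∧
      M = Wᴴ * diagonal (fun i => (d i : ℂ)) * W := by
  obtain ⟨R, hR, hNR⟩ := exists_eq_conjTranspose_mul_self hN.posSemidef
  have hu : IsUnit R.det := by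
    have : IsUnit (Rᴴ * R) := hNR ▸ hN.isUnit
    rw [isUnit_iff_isUnit_det, det_mul] at this
    exact isUnit_of_mul_isUnit_right this
  have hRR : R⁻¹ * R = 1 := nonsing_inv_mul _ hu
  have hRR' : R * R⁻¹ = 1 := mul_nonsing_inv _ hu
  have hRi : (R⁻¹)ᴴ = R⁻¹ := by rw [conjTranspose_nonsing_inv, hR]
  have hX : (R⁻¹ * M * R⁻¹).IsHermitian := by
    rw [IsHermitian, conjTranspose_mul, conjTranspose_mul, hRi, hM.eq, Matrix.mul_assoc]
  obtain ⟨U, hU, hU', h⟩ := exists_unitary_diagonal hX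
  refine ⟨R⁻¹ * U, Uᴴ * R, hX.eigenvalues, ?_, ?_, ?_, ?_⟩
  · rw [Matrix.mul_assoc, ← Matrix.mul_assoc U, hU', Matrix.one_mul, hRR]
  · rw [Matrix.mul_assoc, ← Matrix.mul_assoc R, hRR', Matrix.one_mul, hU]
  · rw [conjTranspose_mul, conjTranspose_conjTranspose, Matrix.mul_assoc, ← Matrix.mul_assoc U,
      hU', Matrix.one_mul, hNR]
  · have e : M = R * (R⁻¹ * M * R⁻¹) * R := by
      calc M = (R * R⁻¹) * M * (R⁻¹ * R) := by rw [hRR, hRR', Matrix.one_mul, Matrix.mul_one]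
        _ = _ := by simp only [Matrix.mul_assoc]
    rw [conjTranspose_mul, conjTranspose_conjTranspose, hR.eq]
    conv_lhs => rw [e, h]
    simp only [Matrix.mul_assoc]

/-- The secrecy rate for unit noise. -/
def nrate (H : Matrix m n ℂ) (G : Matrix p n ℂ) (K : Matrix n n ℂ) : ℝ :=
  logDet (1 + H * K * Hᴴ) - logDet (1 + G * K * Gᴴ)

theorem det_one_add_conj_mul_inv (A S : Matrix n n ℂ) (V : Matrix n m ℂ)
    (hQ : (Vᴴ * S * V).PosDef) :
    (1 + A * (V * (Vᴴ * S * V)⁻¹ * Vᴴ)).det = (Vᴴ * (S + A) * V).det * ((Vᴴ * S * V)⁻¹).det := by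
  have h := mul_inv_of_posDef hQ
  have e : A * (V * (Vᴴ * S * V)⁻¹ * Vᴴ) = (A * V * (Vᴴ * S * V)⁻¹) * Vᴴ := by
    simp only [Matrix.mul_assoc]
  rw [e, det_one_add_mul_comm, ← det_mul]
  congr 1
  nth_rw 1 [← h]
  simp only [Matrix.mul_add, Matrix.add_mul, Matrix.mul_assoc]

/-- For a nonsingular covariance constraint `S` there is a channel `Gᴴ G + Dᴴ D` that is better
than both `H` and `G`, whose secrecy rate at `S` is achieved by `H` at some `K ≤ S`. -/
theorem exists_enhanced (H : Matrix m n ℂ) (G : Matrix p n ℂ) {S : Matrix n n ℂ}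
    (hS : S.PosDef) :
    ∃ D K : Matrix n n ℂ, (Gᴴ * G + Dᴴ * D - Hᴴ * H).PosSemidef ∧ K.PosSemidef ∧
      (S - K).PosSemidef ∧ logDet (1 + D * errCov G S * Dᴴ) = nrate H G K := by
  have hSi := hS.inv
  have hN : (S⁻¹ + Gᴴ * G).PosDef := hSi.add_posSemidef (posSemidef_conjTranspose_mul_self G)
  have hM : (S⁻¹ + Hᴴ * H).PosDef := hSi.add_posSemidef (posSemidef_conjTranspose_mul_self H)
  obtain ⟨C, W, d, hCW, hWC, hNW, hMW⟩ := exists_simultaneous_diagonal hM.1 hN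
  -- In these coordinates S⁻¹ + G†G has entries 1 and S⁻¹ + H†H has entries d i. Their entrywise
  -- maximum defines the enhanced channel.
  set e : n → ℝ := fun i => max (d i) 1 with he
  have hWW : Wᴴ * W = Wᴴ * diagonal (fun _ => (1:ℂ)) * W := by
    rw [diagonal_one, Matrix.mul_one]
  have hdiag : ∀ f g : n → ℝ, (∀ i, f i ≤ g i) → (Wᴴ * diagonal (fun i => (g i : ℂ)) * W -
      Wᴴ * diagonal (fun i => (f i : ℂ)) * W).PosSemidef := by
    intro f g hfg
    rw [← Matrix.sub_mul, ← Matrix.mul_sub, diagonal_sub]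
    refine PosSemidef.conjTranspose_mul_mul_same (PosSemidef.diagonal ?_) W
    intro i
    simp only [Pi.zero_apply]
    rw [← Complex.ofReal_sub]
    exact Complex.zero_le_real.2 (sub_nonneg.2 (hfg i))
  set Mt := Wᴴ * diagonal (fun i => (e i : ℂ)) * W with hMt
  have h1 : (Mt - (S⁻¹ + Gᴴ * G)).PosSemidef := by
    have := hdiag (fun _ => 1) e (fun i => le_max_right _ _)
    simpa [hNW] using this
  have h2 : (Mt - (S⁻¹ + Hᴴ * H)).PosSemidef := by
    rw [hMW]; exact hdiag d e (fun i => le_max_left _ _)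
  obtain ⟨D, -, hD⟩ := exists_eq_conjTranspose_mul_self h1
  have hBD : Gᴴ * G + Dᴴ * D = Mt - S⁻¹ := by rw [← hD]; abel
  -- Only the coordinates in which H beats G carry signal. The enhanced channel has no advantage
  -- over G in the others, so nothing is lost.
  let V : Matrix n {i // 1 < d i} ℂ := C.submatrix id Subtype.val
  have hsub : ∀ X : Matrix n n ℂ, Vᴴ * X * V = (Cᴴ * X * C).submatrix Subtype.val Subtype.val := by
    intro X; ext i j; simp [V, Matrix.mul_apply]
  have hCW' : Cᴴ * Wᴴ = 1 := by rw [← conjTranspose_mul, hWC, conjTranspose_one]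
  have hVN : Vᴴ * (S⁻¹ + Gᴴ * G) * V = 1 := by
    rw [hsub, hNW]
    have : Cᴴ * (Wᴴ * W) * C = 1 := by
      rw [← Matrix.mul_assoc, hCW', Matrix.one_mul, hWC]
    rw [this, submatrix_one _ Subtype.val_injective]
  have hVM : Vᴴ * (S⁻¹ + Hᴴ * H) * V = diagonal (fun i : {i // 1 < d i} => (d i : ℂ)) := by
    rw [hsub, hMW]
    have : Cᴴ * (Wᴴ * diagonal (fun i => (d i : ℂ)) * W) * C = diagonal (fun i => (d i : ℂ)) := by
      calc _ = (Cᴴ * Wᴴ) * diagonal (fun i => (d i : ℂ)) * (W * C) := by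
            simp only [Matrix.mul_assoc]
        _ = _ := by rw [hCW', hWC, Matrix.one_mul, Matrix.mul_one]
    rw [this, submatrix_diagonal _ _ Subtype.val_injective]; rfl
  have hinj : Function.Injective V.mulVec := by
    intro x y hxy
    have : (Vᴴ * (S⁻¹ + Gᴴ * G)) *ᵥ (V *ᵥ x) = (Vᴴ * (S⁻¹ + Gᴴ * G)) *ᵥ (V *ᵥ y) :=
      congrArg _ hxy
    simpa [mulVec_mulVec, hVN] using this
  have hQ : (Vᴴ * S⁻¹ * V).PosDef := hSi.conjTranspose_mul_mul_same hinj
  set Q := Vᴴ * S⁻¹ * V with hQdef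
  set K := V * Q⁻¹ * Vᴴ with hK
  have hKp : K.PosSemidef := hQ.inv.posSemidef.mul_mul_conjTranspose_same V
  have hKH : Kᴴ = K := hKp.1
  have hSH : Sᴴ = S := hS.1
  -- Equivalently, S^(-1/2) K S^(-1/2) is an orthogonal projection, whence K ⪯ S.
  have hKSK : K * S⁻¹ * K = K := by
    have : V * Q⁻¹ * Vᴴ * S⁻¹ * (V * Q⁻¹ * Vᴴ) = V * Q⁻¹ * (Vᴴ * S⁻¹ * V) * Q⁻¹ * Vᴴ := by
      simp only [Matrix.mul_assoc]
    rw [hK, this, ← hQdef, Matrix.mul_assoc V, inv_mul_of_posDef hQ, Matrix.mul_one]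
  have hSK : S - K = (S - K) * S⁻¹ * (S - K)ᴴ := by
    rw [conjTranspose_sub, hKH, hSH, Matrix.sub_mul, mul_inv_of_posDef hS, Matrix.sub_mul,
      Matrix.mul_sub (K * S⁻¹), hKSK, Matrix.mul_assoc, inv_mul_of_posDef hS]
    simp
  refine ⟨D, K, ?_, hKp, ?_, ?_⟩
  · rw [hBD, sub_sub]; exact h2
  · rw [hSK]; exact hSi.posSemidef.mul_mul_conjTranspose_same _
  · have k1 := det_one_add_add_mul G D hS.posSemidef
    have k2 : (1 + (Gᴴ * G + Dᴴ * D) * S).det = Mt.det * S.det := by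
      rw [hBD, Matrix.sub_mul, inv_mul_of_posDef hS, add_sub_cancel, det_mul]
    have k3 : (1 + G * S * Gᴴ).det = (S⁻¹ + Gᴴ * G).det * S.det := by
      rw [det_one_add_conj, ← det_mul, Matrix.add_mul, inv_mul_of_posDef hS]
    have k4 : (1 + G * K * Gᴴ).det = (Q⁻¹).det := by
      rw [det_one_add_conj, hK, det_one_add_conj_mul_inv _ _ V hQ, hVN, det_one, one_mul]
    have k5 : (1 + H * K * Hᴴ).det = (∏ i : {i // 1 < d i}, (d i : ℂ)) * (Q⁻¹).det := by
      rw [det_one_add_conj, hK, det_one_add_conj_mul_inv _ _ V hQ, hVM, det_diagonal]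
    have k6 : Mt.det = (∏ i : {i // 1 < d i}, (d i : ℂ)) * (S⁻¹ + Gᴴ * G).det := by
      rw [hMt, hNW, det_mul, det_mul, det_mul, det_diagonal]
      have : ∏ i, (e i : ℂ) = ∏ i : {i // 1 < d i}, (d i : ℂ) := by
        rw [← Finset.prod_subtype (Finset.univ.filter fun i => 1 < d i) (by simp)
          (fun i => (d i : ℂ)), Finset.prod_filter]
        refine Finset.prod_congr rfl fun i _ => ?_
        split_ifs with h
        · rw [he]; simp [max_eq_left h.le]
        · rw [he]; simp [max_eq_right (not_lt.1 h)]
      rw [this]; ring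
    have p1 := posDef_one_add_conj D (posSemidef_errCov G hS.posSemidef)
    have p2 := posDef_one_add_conj G hKp
    have hNd : (S⁻¹ + Gᴴ * G).det * S.det ≠ 0 := mul_ne_zero hN.det_pos.ne' hS.det_pos.ne'
    have k7 : (1 + D * errCov G S * Dᴴ).det = ∏ i : {i // 1 < d i}, (d i : ℂ) := by
      apply mul_right_cancel₀ hNd
      rw [← k3, ← k1, k2, k6, k3]; ring
    have k8 : (1 + H * K * Hᴴ).det = (1 + D * errCov G S * Dᴴ).det * (1 + G * K * Gᴴ).det := by
      rw [k5, k4, k7]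
    rw [nrate, logDet_eq_add_of_det_eq p1 p2 k8]; ring

/-- Replacing H by the better stacked channel (G, D) increases the first log det, and by the chain
rule what remains after subtracting the rate of G is the right-hand side. -/
theorem nrate_le_logDet_errCov (H : Matrix m n ℂ) (G : Matrix p n ℂ) {q : Type*} [Fintype q]
    [DecidableEq q] {D : Matrix q n ℂ}
    (hD : (Gᴴ * G + Dᴴ * D - Hᴴ * H).PosSemidef) {S : Matrix n n ℂ} (hS : S.PosSemidef) :
    nrate H G S ≤ logDet (1 + D * errCov G S * Dᴴ) := by
  have p1 := posDef_one_add_conj D (posSemidef_errCov G hS)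
  have p2 := posDef_one_add_conj G hS
  have k1 := logDet_eq_add_of_det_eq p1 p2 (det_one_add_add_mul G D hS)
  obtain ⟨k, hk, hSk⟩ := exists_eq_conjTranspose_mul_self hS
  have e : ∀ A : Matrix n n ℂ, (1 + A * S).det = (1 + k * A * kᴴ).det := by
    intro A
    rw [hSk, ← Matrix.mul_assoc, det_one_add_mul_comm, Matrix.mul_assoc]
  have k2 : logDet (1 + H * S * Hᴴ) ≤ logDet (1 + (Gᴴ * G + Dᴴ * D) * S) := by
    have : logDet (1 + H * S * Hᴴ) = logDet (1 + k * (Hᴴ * H) * kᴴ) := by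
      rw [logDet, logDet, det_one_add_conj, e]
    rw [this]
    have : logDet (1 + (Gᴴ * G + Dᴴ * D) * S) = logDet (1 + k * (Gᴴ * G + Dᴴ * D) * kᴴ) := by
      rw [logDet, logDet, e]
    rw [this]
    apply logDet_mono (posDef_one_add_conj k (posSemidef_conjTranspose_mul_self H))
    rw [add_sub_add_left_eq_sub, ← Matrix.sub_mul, ← Matrix.mul_sub]
    exact hD.mul_mul_conjTranspose_same k
  rw [nrate]
  linarith

/-- Concavity of the maximal rate in the power: the channel enhanced at the mixture bounds both
endpoint rates, is concave, and at the mixture is matched by H at some smaller K. -/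
theorem exists_nrate_comb_le (H : Matrix m n ℂ) (G : Matrix p n ℂ) {S₁ S₂ : Matrix n n ℂ}
    (h₁ : S₁.PosSemidef) (h₂ : S₂.PosSemidef) {a b : ℝ} (ha : 0 ≤ a) (hb : 0 ≤ b)
    (hab : a + b = 1) (hS : (a • S₁ + b • S₂).PosDef) :
    ∃ K : Matrix n n ℂ, K.PosSemidef ∧ K.trace.re ≤ a * S₁.trace.re + b * S₂.trace.re ∧
      a * nrate H G S₁ + b * nrate H G S₂ ≤ nrate H G K := by
  obtain ⟨D, K, hD, hK, hSK, h⟩ := exists_enhanced H G hS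
  refine ⟨K, hK, ?_, ?_⟩
  · have := trace_re_nonneg hSK
    rw [trace_sub, trace_add, trace_smul, trace_smul, Complex.sub_re, Complex.add_re,
      Complex.smul_re, Complex.smul_re, smul_eq_mul, smul_eq_mul] at this
    linarith
  · rw [← h]
    refine le_trans (add_le_add ?_ ?_) (logDet_errCov_concave G D h₁ h₂ ha hb hab)
    · exact mul_le_mul_of_nonneg_left (nrate_le_logDet_errCov H G hD h₁) ha
    · exact mul_le_mul_of_nonneg_left (nrate_le_logDet_errCov H G hD h₂) hb

end Enhanced

/-- A smooth function touching g from below forces the left derivative of g to be at most its right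
derivative; concavity gives the reverse. -/
theorem ConcaveOn.differentiableAt_of_touches {g ψ : ℝ → ℝ} {t : ℝ}
    (hg : ConcaveOn ℝ (Set.Ici 0) g) (ht : 0 < t) (hψ : DifferentiableAt ℝ ψ t)
    (heq : ψ t = g t) (hle : ∀ s, 0 < s → ψ s ≤ g s) : DifferentiableAt ℝ g t := by
  have hc : ConvexOn ℝ (Set.Ici 0) (-g) := hg.neg
  have hti : t ∈ interior (Set.Ici (0:ℝ)) := by rwa [interior_Ici]
  have hr := hc.hasDerivWithinAt_rightDeriv_of_mem_interior hti
  have hl := hc.hasDerivWithinAt_leftDeriv_of_mem_interior hti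
  have hlr := hc.leftDeriv_le_rightDeriv_of_mem_interior hti
  have hd := hψ.hasDerivAt.neg
  have hpos : ∀ᶠ s in 𝓝 t, 0 < s := lt_mem_nhds ht
  have e1 : derivWithin (-g) (Set.Ioi t) t ≤ - deriv ψ t := by
    refine le_of_tendsto_of_tendsto (hasDerivWithinAt_iff_tendsto_slope' (by simp) |>.1 hr)
      (hasDerivWithinAt_iff_tendsto_slope' (by simp) |>.1 (hd.hasDerivWithinAt (s := Set.Ioi t))) ?_
    filter_upwards [self_mem_nhdsWithin, nhdsWithin_le_nhds hpos] with s hs hs0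
    rw [slope_def_field, slope_def_field]
    have : 0 < s - t := sub_pos.2 hs
    refine div_le_div_of_nonneg_right ?_ this.le
    have := hle s hs0
    simp only [Pi.neg_apply]; linarith
  have e2 : - deriv ψ t ≤ derivWithin (-g) (Set.Iio t) t := by
    refine le_of_tendsto_of_tendsto (hasDerivWithinAt_iff_tendsto_slope' (by simp) |>.1
      (hd.hasDerivWithinAt (s := Set.Iio t)))
      (hasDerivWithinAt_iff_tendsto_slope' (by simp) |>.1 hl) ?_
    filter_upwards [self_mem_nhdsWithin, nhdsWithin_le_nhds hpos] with s hs hs0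
    rw [slope_def_field, slope_def_field]
    have : s - t < 0 := sub_neg.2 hs
    refine div_le_div_of_nonpos_of_le this.le ?_
    have := hle s hs0
    simp only [Pi.neg_apply]; linarith
  have e3 : derivWithin (-g) (Set.Ioi t) t = derivWithin (-g) (Set.Iio t) t := by linarith
  rw [← e3] at hl
  have h2 := hl.Iic_of_Iio.union hr.Ici_of_Ioi
  rw [Set.Iic_union_Ici, hasDerivWithinAt_univ] at h2
  simpa using h2.differentiableAt.neg

/-! ### The maximal rate as a function of the power -/

section Gain

variable {n m p : Type*} [Fintype n] [DecidableEq n] [Fintype m] [DecidableEq m]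
  [Fintype p] [DecidableEq p]

/-- The covariance matrices with power at most `t`. -/
def covSet (n : Type*) [Fintype n] (t : ℝ) : Set (Matrix n n ℂ) :=
  {K | K.PosSemidef ∧ K.trace.re ≤ t}

/-- The maximal secrecy rate for unit noise with power `t`. -/
def gain (H : Matrix m n ℂ) (G : Matrix p n ℂ) (t : ℝ) : ℝ :=
  sSup (nrate H G '' covSet n t)

theorem trace_mul_self_hermitian_re {X : Matrix n n ℂ} (hX : X.IsHermitian) :
    (X * X).trace.re = ∑ i, ∑ j, ‖X i j‖ ^ 2 := by
  simp only [trace, diag_apply, Matrix.mul_apply, Complex.re_sum]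
  refine Finset.sum_congr rfl fun i _ => Finset.sum_congr rfl fun j _ => ?_
  have : X j i = star (X i j) := by
    conv_lhs => rw [← hX.eq]
    rfl
  rw [this, ← Complex.normSq_eq_norm_sq]
  change (X i j * (starRingEnd ℂ) (X i j)).re = _
  rw [Complex.mul_conj, Complex.ofReal_re]

theorem norm_apply_le_trace {X : Matrix n n ℂ} (hX : X.PosSemidef) (i j : n) :
    ‖X i j‖ ≤ X.trace.re := by
  refine le_of_sq_le_sq ?_ (trace_re_nonneg hX)
  refine le_trans ?_ (trace_mul_self_le hX)
  rw [trace_mul_self_hermitian_re hX.1]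
  refine le_trans ?_ (Finset.single_le_sum (fun i _ => Finset.sum_nonneg fun j _ => by positivity)
    (Finset.mem_univ i))
  exact Finset.single_le_sum (f := fun j => ‖X i j‖ ^ 2) (fun j _ => by positivity)
    (Finset.mem_univ j)

theorem isClosed_posSemidef : IsClosed {K : Matrix n n ℂ | K.PosSemidef} := by
  have : {K : Matrix n n ℂ | K.PosSemidef} =
      {K | Kᴴ = K} ∩ ⋂ x : n → ℂ, {K | 0 ≤ star x ⬝ᵥ (K *ᵥ x)} := by
    ext K
    simp only [Set.mem_ofPred_eq, Set.mem_inter_iff, Set.mem_iInter,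
      posSemidef_iff_dotProduct_mulVec]
    rfl
  rw [this]
  refine (isClosed_eq (by fun_prop) continuous_id).inter (isClosed_iInter fun x => ?_)
  refine isClosed_le continuous_const ?_
  fun_prop

theorem isCompact_covSet (t : ℝ) : IsCompact (covSet n t) := by
  have hK : IsCompact (Set.univ.pi fun _ : n => Set.univ.pi fun _ : n =>
      Metric.closedBall (0 : ℂ) t) :=
    isCompact_univ_pi fun _ => isCompact_univ_pi fun _ => isCompact_closedBall _ _
  refine IsCompact.of_isClosed_subset hK ?_ ?_
  · have : covSet n t = {K | K.PosSemidef} ∩ {K | K.trace.re ≤ t} := by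
      ext K; rfl
    rw [this]
    refine isClosed_posSemidef.inter (isClosed_le ?_ continuous_const)
    exact Complex.continuous_re.comp (continuous_id.matrix_trace)
  · rintro K ⟨h1, h2⟩ i - j -
    rw [mem_closedBall_zero_iff]
    exact (norm_apply_le_trace h1 i j).trans h2

theorem continuousAt_nrate (H : Matrix m n ℂ) (G : Matrix p n ℂ) {K : Matrix n n ℂ}
    (hK : K.PosSemidef) : ContinuousAt (nrate H G) K := by
  unfold nrate logDet
  refine ContinuousAt.sub ?_ ?_
  · refine ContinuousAt.log (Continuous.continuousAt ?_)
      (det_re_pos (posDef_one_add_conj H hK)).ne'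
    exact Complex.continuous_re.comp (Continuous.matrix_det (by fun_prop))
  · refine ContinuousAt.log (Continuous.continuousAt ?_)
      (det_re_pos (posDef_one_add_conj G hK)).ne'
    exact Complex.continuous_re.comp (Continuous.matrix_det (by fun_prop))

theorem zero_mem_covSet {t : ℝ} (ht : 0 ≤ t) : (0 : Matrix n n ℂ) ∈ covSet n t :=
  ⟨PosSemidef.zero, by simpa⟩

theorem bddAbove_nrate (H : Matrix m n ℂ) (G : Matrix p n ℂ) (t : ℝ) :
    BddAbove (nrate H G '' covSet n t) :=
  (isCompact_covSet t).bddAbove_image fun _ hK => (continuousAt_nrate H G hK.1).continuousWithinAt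

theorem nrate_le_gain (H : Matrix m n ℂ) (G : Matrix p n ℂ) {t : ℝ} {K : Matrix n n ℂ}
    (hK : K ∈ covSet n t) : nrate H G K ≤ gain H G t :=
  le_csSup (bddAbove_nrate H G t) ⟨K, hK, rfl⟩

theorem exists_nrate_eq_gain (H : Matrix m n ℂ) (G : Matrix p n ℂ) {t : ℝ} (ht : 0 ≤ t) :
    ∃ K ∈ covSet n t, nrate H G K = gain H G t := by
  have hc : IsCompact (nrate H G '' covSet n t) := (isCompact_covSet t).image_of_continuousOn
    fun _ hK => (continuousAt_nrate H G hK.1).continuousWithinAt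
  obtain ⟨K, hK, h⟩ := hc.sSup_mem ⟨_, 0, zero_mem_covSet ht, rfl⟩
  exact ⟨K, hK, h⟩

theorem nrate_zero (H : Matrix m n ℂ) (G : Matrix p n ℂ) : nrate H G 0 = 0 := by
  simp [nrate, logDet]

theorem gain_nonneg (H : Matrix m n ℂ) (G : Matrix p n ℂ) {t : ℝ} (ht : 0 ≤ t) :
    0 ≤ gain H G t := by
  rw [← nrate_zero H G]; exact nrate_le_gain H G (zero_mem_covSet ht)

/-- The hypothesis says that D = √ℓ · 1 enhances the channel. Then log det(1 + ℓE) ≤ ℓ tr E, and the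
error covariance E is at most K. -/
theorem nrate_le_mul_trace {H : Matrix m n ℂ} {G : Matrix p n ℂ} {ℓ : ℝ} (hℓ : 0 ≤ ℓ)
    (h : (ℓ • (1 : Matrix n n ℂ) - (Hᴴ * H - Gᴴ * G)).PosSemidef) {K : Matrix n n ℂ}
    (hK : K.PosSemidef) : nrate H G K ≤ ℓ * K.trace.re := by
  set D : Matrix n n ℂ := Real.sqrt ℓ • 1 with hDdef
  have hDH : Dᴴ = D := by rw [hDdef, conjTranspose_smul, conjTranspose_one]; simp
  have hDD : Dᴴ * D = ℓ • 1 := by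
    rw [hDH, hDdef, Matrix.smul_mul, Matrix.mul_smul, smul_smul, Real.mul_self_sqrt hℓ,
      Matrix.one_mul]
  have hD : (Gᴴ * G + Dᴴ * D - Hᴴ * H).PosSemidef := by
    rw [hDD]; convert h using 1; abel
  refine (nrate_le_logDet_errCov H G hD hK).trans ?_
  have hE := posSemidef_errCov G hK
  refine (logDet_one_add_le_trace (hE.mul_mul_conjTranspose_same D)).trans ?_
  have e : D * errCov G K * Dᴴ = ℓ • errCov G K := by
    rw [hDH, hDdef, Matrix.smul_mul, Matrix.mul_smul, Matrix.smul_mul, smul_smul,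
      Real.mul_self_sqrt hℓ, Matrix.one_mul, Matrix.mul_one]
  rw [e, trace_smul, Complex.smul_re, smul_eq_mul]
  refine mul_le_mul_of_nonneg_left ?_ hℓ
  have := trace_re_nonneg (posSemidef_sub_errCov G hK)
  rw [trace_sub, Complex.sub_re] at this
  linarith

theorem gain_le_mul {H : Matrix m n ℂ} {G : Matrix p n ℂ} {ℓ : ℝ} (hℓ : 0 ≤ ℓ)
    (h : (ℓ • (1 : Matrix n n ℂ) - (Hᴴ * H - Gᴴ * G)).PosSemidef) {t : ℝ} (ht : 0 ≤ t) :
    gain H G t ≤ ℓ * t := by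
  obtain ⟨K, hK, e⟩ := exists_nrate_eq_gain H G ht
  rw [← e]
  exact (nrate_le_mul_trace hℓ h hK.1).trans (mul_le_mul_of_nonneg_left hK.2 hℓ)

theorem gain_zero (H : Matrix m n ℂ) (G : Matrix p n ℂ) : gain H G 0 = 0 := by
  obtain ⟨K, hK, e⟩ := exists_nrate_eq_gain H G le_rfl
  have : K = 0 := by
    ext i j
    have := (norm_apply_le_trace hK.1 i j).trans hK.2
    simpa using this
  rw [← e, this, nrate_zero]

theorem posDef_smul_one {c : ℝ} (hc : 0 < c) : (c • (1 : Matrix n n ℂ)).PosDef :=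
  PosDef.one.smul hc

theorem trace_re_comb (a b : ℝ) (X Y : Matrix n n ℂ) :
    (a • X + b • Y).trace.re = a * X.trace.re + b * Y.trace.re := by
  rw [trace_add, trace_smul, trace_smul, Complex.add_re, Complex.smul_re, Complex.smul_re,
    smul_eq_mul, smul_eq_mul]

theorem concaveOn_gain [Nonempty n] (H : Matrix m n ℂ) (G : Matrix p n ℂ) :
    ConcaveOn ℝ (Set.Ici 0) (gain H G) := by
  refine ⟨convex_Ici 0, fun x hx y hy a b ha hb hab => ?_⟩
  rw [Set.mem_Ici] at hx hy
  simp only [smul_eq_mul]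
  rcases ha.eq_or_lt with rfl | ha'
  · have : b = 1 := by linarith
    subst this; simp
  rcases hb.eq_or_lt with rfl | hb'
  · have : a = 1 := by linarith
    subst this; simp
  by_cases hxy : x = 0 ∧ y = 0
  · simp [hxy, gain_zero]
  have hpos : 0 < a * x + b * y := by
    by_contra hcon
    have h1 : 0 ≤ a * x := by positivity
    have h2 : 0 ≤ b * y := by positivity
    have h3 : a * x = 0 := by linarith
    have h4 : b * y = 0 := by linarith
    exact hxy ⟨(mul_eq_zero.1 h3).resolve_left ha'.ne', (mul_eq_zero.1 h4).resolve_left hb'.ne'⟩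
  obtain ⟨K₁, hK₁, e₁⟩ := exists_nrate_eq_gain H G hx
  obtain ⟨K₂, hK₂, e₂⟩ := exists_nrate_eq_gain H G hy
  rw [← e₁, ← e₂]
  have hN : (0 : ℝ) < Fintype.card n := by exact_mod_cast Fintype.card_pos
  -- Enhancement needs a nonsingular mixture. Mixing in an isotropic input of trace z keeps the
  -- power constraint, and ε → 0 recovers the optimal inputs.
  set P : Matrix n n ℂ → ℝ → ℝ → Matrix n n ℂ := fun K z ε =>
    (1 - ε) • K + (ε * (z / Fintype.card n)) • (1 : Matrix n n ℂ) with hP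
  have hPp : ∀ K z ε, K ∈ covSet n z → 0 ≤ z → 0 < ε → ε < 1 → P K z ε ∈ covSet n z := by
    intro K z ε hK hz h0 h1
    refine ⟨(hK.1.smul (by linarith)).add (PosSemidef.one.smul (by positivity)), ?_⟩
    rw [hP]
    simp only
    rw [trace_re_comb, trace_one, Complex.natCast_re]
    have : ε * (z / Fintype.card n) * Fintype.card n = ε * z := by field_simp
    rw [this]
    nlinarith [hK.2]
  have hPt : ∀ K z, K ∈ covSet n z → Tendsto (fun ε => nrate H G (P K z ε)) (𝓝[>] 0)
      (𝓝 (nrate H G K)) := by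
    intro K z hK
    have h0 : Tendsto (P K z) (𝓝[>] 0) (𝓝 K) := by
      have : Continuous (P K z) := by fun_prop
      have := this.tendsto 0
      simp only [hP, sub_zero, one_smul, zero_mul, zero_smul, add_zero] at this
      exact this.mono_left nhdsWithin_le_nhds
    exact (continuousAt_nrate H G hK.1).tendsto.comp h0
  refine le_of_tendsto (((hPt K₁ x hK₁).const_mul a).add ((hPt K₂ y hK₂).const_mul b)) ?_
  filter_upwards [Ioo_mem_nhdsGT (show (0:ℝ) < 1 by norm_num)] with ε hε
  have m₁ := hPp K₁ x ε hK₁ hx hε.1 hε.2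
  have m₂ := hPp K₂ y ε hK₂ hy hε.1 hε.2
  have hS : (a • P K₁ x ε + b • P K₂ y ε).PosDef := by
    have : a • P K₁ x ε + b • P K₂ y ε = (ε * ((a * x + b * y) / Fintype.card n)) • 1 +
        ((a * (1 - ε)) • K₁ + (b * (1 - ε)) • K₂) := by
      simp only [hP, smul_add, smul_smul]
      have : ε * ((a * x + b * y) / Fintype.card n) =
        a * (ε * (x / Fintype.card n)) + b * (ε * (y / Fintype.card n)) := by ring
      rw [this, add_smul]
      abel
    rw [this]
    have h1 : 0 ≤ 1 - ε := by linarith [hε.2]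
    have h2 := hε.1
    exact (posDef_smul_one (by positivity)).add_posSemidef
      ((hK₁.1.smul (by positivity)).add (hK₂.1.smul (by positivity)))
  obtain ⟨K, hK, htr, hle⟩ := exists_nrate_comb_le H G m₁.1 m₂.1 ha hb hab hS
  refine hle.trans (nrate_le_gain H G ⟨hK, htr.trans ?_⟩)
  exact add_le_add (mul_le_mul_of_nonneg_left m₁.2 ha) (mul_le_mul_of_nonneg_left m₂.2 hb)

theorem differentiableAt_logDet_conj {K : Matrix n n ℂ} (hK : K.PosSemidef) (V : Matrix m n ℂ)
    {t : ℝ} (ht : 0 < t) :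
    DifferentiableAt ℝ (fun s : ℝ => logDet (1 + V * ((s / t) • K) * Vᴴ)) t := by
  have h1 := differentiableAt_logDet_one_add_smul
    (hK.mul_mul_conjTranspose_same V) (s := t / t) (by positivity)
  have h2 : DifferentiableAt ℝ (fun s : ℝ => s / t) t := by fun_prop
  have h3 := DifferentiableAt.comp (f := fun s : ℝ => s / t) t h1 h2
  simpa only [Function.comp_def, Matrix.mul_smul, Matrix.smul_mul] using h3

/-- The rate along the ray through a maximizer at power t is differentiable, stays feasible, and
touches the gain at t. -/
theorem differentiableAt_gain [Nonempty n] (H : Matrix m n ℂ) (G : Matrix p n ℂ) {t : ℝ}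
    (ht : 0 < t) : DifferentiableAt ℝ (gain H G) t := by
  obtain ⟨K, hK, e⟩ := exists_nrate_eq_gain H G ht.le
  refine ConcaveOn.differentiableAt_of_touches (ψ := fun s => nrate H G ((s / t) • K))
    (concaveOn_gain H G) ht ?_ (by simp [ht.ne', e]) ?_
  · exact (differentiableAt_logDet_conj hK.1 H ht).sub (differentiableAt_logDet_conj hK.1 G ht)
  · intro s hs
    refine nrate_le_gain H G ⟨hK.1.smul (by positivity), ?_⟩
    rw [trace_smul, Complex.smul_re, smul_eq_mul]
    calc s / t * K.trace.re ≤ s / t * t := mul_le_mul_of_nonneg_left hK.2 (by positivity)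
      _ = s := by field_simp

end Gain

/-- `g` is a nonnegative, monotone, concave function on the half-line that vanishes at `0`,
is differentiable off `0`, and satisfies `L t - q t² / 2 ≤ g t ≤ L t`. -/
structure IsGain (g : ℝ → ℝ) (L q : ℝ) : Prop where
  concave : ConcaveOn ℝ (Set.Ici 0) g
  mono : MonotoneOn g (Set.Ici 0)
  zero : g 0 = 0
  upper : ∀ t, 0 ≤ t → g t ≤ L * t
  lower : ∀ t, 0 ≤ t → L * t - q * t ^ 2 / 2 ≤ g t
  diff : ∀ t, 0 < t → DifferentiableAt ℝ g t

/-! ### Secant estimates for concave functions -/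

namespace IsGain

variable {g : ℝ → ℝ} {L q : ℝ} (h : IsGain g L q)
include h

theorem nonneg {t : ℝ} (ht : 0 ≤ t) : 0 ≤ g t := by
  rw [← h.zero]; exact h.mono Set.self_mem_Ici ht ht

theorem deriv_nonneg {t : ℝ} (ht : 0 < t) : 0 ≤ deriv g t := by
  have h1 := h.concave.slope_le_deriv (x := t) (y := t + 1) ht.le
    (by rw [Set.mem_Ici]; linarith) (by linarith) (h.diff t ht)
  refine le_trans ?_ h1
  rw [slope_def_field]
  have := h.mono (a := t) (b := t + 1) ht.le (by rw [Set.mem_Ici]; linarith) (by linarith)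
  simpa using this

theorem deriv_le {t : ℝ} (ht : 0 < t) : deriv g t ≤ L := by
  have h1 := h.concave.deriv_le_slope (x := 0) (y := t) Set.self_mem_Ici ht.le ht (h.diff t ht)
  refine h1.trans ?_
  rw [slope_def_field, h.zero, sub_zero, sub_zero, div_le_iff₀ ht]
  exact h.upper t ht.le

theorem slope_add_le_deriv {t η : ℝ} (ht : 0 < t) (hη : 0 < η) :
    (g (t + η) - g t) / η ≤ deriv g t := by
  have h1 := h.concave.slope_le_deriv (x := t) (y := t + η) ht.le
    (by rw [Set.mem_Ici]; linarith) (by linarith) (h.diff t ht)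
  rwa [slope_def_field, add_sub_cancel_left] at h1

theorem deriv_le_slope_sub {t η : ℝ} (ht : 0 < t) (hη : 0 < η) (hηt : η ≤ t) :
    deriv g t ≤ (g t - g (t - η)) / η := by
  have h1 := h.concave.deriv_le_slope (x := t - η) (y := t) (by rw [Set.mem_Ici]; linarith) ht.le
    (by linarith) (h.diff t ht)
  rwa [slope_def_field, sub_sub_cancel] at h1

/-- The secant over [t, 2t] is at least (2Lt − 2qt² − Lt)/t = L − 2qt. This bound is the integrable
majorant for the second derivative. -/
theorem abs_deriv_sub_div_le {t : ℝ} (ht : 0 < t) : |(deriv g t - L) / t| ≤ 2 * q := by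
  have h1 := h.slope_add_le_deriv ht ht
  have h2 := h.lower (t + t) (by linarith)
  have h3 := h.upper t ht.le
  have h4 := h.deriv_le ht
  rw [div_le_iff₀ ht] at h1
  rw [abs_le, le_div_iff₀ ht, div_le_iff₀ ht]
  have h5 : 0 ≤ q := by
    have h6 := h.lower 1 zero_le_one
    have h7 := h.upper 1 zero_le_one
    linarith
  constructor
  · by_contra hcon
    push Not at hcon
    have : (deriv g t - L) * t < -(2 * q) * t * t := mul_lt_mul_of_pos_right hcon ht
    nlinarith
  · have : 0 ≤ 2 * q * t := by positivity
    linarith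

theorem hasDerivWithinAt_zero : HasDerivWithinAt g L (Set.Ici 0) 0 := by
  rw [hasDerivWithinAt_iff_tendsto_slope, Set.Ici_sdiff_left]
  have h1 : Tendsto (fun t : ℝ => L - q * t / 2) (𝓝[>] 0) (𝓝 L) := by
    have : Continuous (fun t : ℝ => L - q * t / 2) := by fun_prop
    have := this.tendsto 0
    simp only [mul_zero, zero_div, sub_zero] at this
    exact this.mono_left nhdsWithin_le_nhds
  refine tendsto_of_tendsto_of_tendsto_of_le_of_le' h1 tendsto_const_nhds ?_ ?_
  · filter_upwards [self_mem_nhdsWithin] with t ht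
    rw [Set.mem_Ioi] at ht
    rw [slope_def_field, h.zero, sub_zero, sub_zero, le_div_iff₀ ht]
    have := h.lower t ht.le
    nlinarith
  · filter_upwards [self_mem_nhdsWithin] with t ht
    rw [Set.mem_Ioi] at ht
    rw [slope_def_field, h.zero, sub_zero, sub_zero, div_le_iff₀ ht]
    exact h.upper t ht.le

/-- An expansion of a function does not in general differentiate; for a concave one it does, because
the derivative lies between the secants to t + ηt and t − ηt. -/
theorem tendsto_deriv_sub_div
    (hq : ∀ ε > 0, ∀ᶠ t in 𝓝[>] (0:ℝ), g t ≤ L * t - (q - ε) * t ^ 2 / 2) :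
    Tendsto (fun t => (deriv g t - L) / t) (𝓝[>] 0) (𝓝 (-q)) := by
  have hq0 : 0 ≤ q := by
    have h6 := h.lower 1 zero_le_one
    have h7 := h.upper 1 zero_le_one
    linarith
  rw [Metric.tendsto_nhds]
  intro δ hδ
  set η : ℝ := min (1 / 2) (δ / (q + 1)) with hη
  have hη0 : 0 < η := by positivity
  have hη1 : η ≤ 1 / 2 := min_le_left _ _
  have hη2 : η * (q + 1) ≤ δ := by
    have : η ≤ δ / (q + 1) := min_le_right _ _
    rwa [le_div_iff₀ (by positivity)] at this
  -- Taking η² as the error in the expansion leaves an error of order ηt after division by the step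
  -- ηt. The total is η(q + 1)t/2.
  have hev := hq (η ^ 2) (by positivity)
  filter_upwards [hev, self_mem_nhdsWithin] with t h1 ht
  rw [Set.mem_Ioi] at ht
  have hηt : 0 < η * t := by positivity
  rw [Real.dist_eq, sub_neg_eq_add]
  have key : |(deriv g t - L) / t + q| ≤ η * (q + 1) / 2 := by
    have e : (deriv g t - L) / t + q = (deriv g t - L + q * t) / t := by field_simp
    rw [e, abs_le, le_div_iff₀ ht, div_le_iff₀ ht]
    constructor
    · have a1 := h.slope_add_le_deriv ht hηt
      have a2 := h.lower (t + η * t) (by positivity)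
      have a3 : (L * (t + η * t) - q * (t + η * t) ^ 2 / 2 -
          (L * t - (q - η ^ 2) * t ^ 2 / 2)) / (η * t) ≤ deriv g t :=
        (div_le_div_of_nonneg_right (by linarith) hηt.le).trans a1
      have a4 : (L * (t + η * t) - q * (t + η * t) ^ 2 / 2 -
          (L * t - (q - η ^ 2) * t ^ 2 / 2)) / (η * t)
          = L - q * t - η * (q + 1) / 2 * t := by field_simp; ring
      linarith
    · have a1 := h.deriv_le_slope_sub ht hηt (by nlinarith)
      have a2 := h.lower (t - η * t) (by nlinarith)
      have a3 : deriv g t ≤ (L * t - (q - η ^ 2) * t ^ 2 / 2 -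
          (L * (t - η * t) - q * (t - η * t) ^ 2 / 2)) / (η * t) :=
        a1.trans (div_le_div_of_nonneg_right (by linarith) hηt.le)
      have a4 : (L * t - (q - η ^ 2) * t ^ 2 / 2 -
          (L * (t - η * t) - q * (t - η * t) ^ 2 / 2)) / (η * t)
          = L - q * t + η * (q + 1) / 2 * t := by field_simp; ring
      linarith
  have : 0 < η * (q + 1) := by positivity
  linarith

end IsGain

/-! ### Differentiation under the expectation -/

section Integral

variable {Ω : Type*} [MeasurableSpace Ω] {μ : Measure Ω} {g : Ω → ℝ → ℝ} {L q : Ω → ℝ}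

theorem integrable_gain (h : ∀ ω, IsGain (g ω) (L ω) (q ω)) (hL : Integrable L μ)
    (hm : ∀ t, 0 ≤ t → AEStronglyMeasurable (fun ω => g ω t) μ) {t : ℝ} (ht : 0 ≤ t) :
    Integrable (fun ω => g ω t) μ := by
  refine (hL.mul_const t).mono' (hm t ht) (Eventually.of_forall fun ω => ?_)
  rw [Real.norm_of_nonneg ((h ω).nonneg ht)]
  exact (h ω).upper t ht

theorem hasDerivWithinAt_integral_gain_zero (h : ∀ ω, IsGain (g ω) (L ω) (q ω))
    (hL : Integrable L μ) (hm : ∀ t, 0 ≤ t → AEStronglyMeasurable (fun ω => g ω t) μ) :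
    HasDerivWithinAt (fun t => ∫ ω, g ω t ∂μ) (∫ ω, L ω ∂μ) (Set.Ici 0) 0 := by
  rw [hasDerivWithinAt_iff_tendsto_slope, Set.Ici_sdiff_left]
  have key : Tendsto (fun t => ∫ ω, slope (g ω) 0 t ∂μ) (𝓝[>] 0) (𝓝 (∫ ω, L ω ∂μ)) := by
    refine tendsto_integral_filter_of_dominated_convergence L ?_ ?_ hL ?_
    · filter_upwards [self_mem_nhdsWithin] with t ht
      simp only [slope_def_field, (h _).zero, sub_zero, div_eq_inv_mul]
      exact (hm t (le_of_lt ht)).const_mul _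
    · filter_upwards [self_mem_nhdsWithin] with t ht
      rw [Set.mem_Ioi] at ht
      refine Eventually.of_forall fun ω => ?_
      rw [slope_def_field, (h ω).zero, sub_zero, sub_zero,
        Real.norm_of_nonneg (div_nonneg ((h ω).nonneg ht.le) ht.le), div_le_iff₀ ht]
      exact (h ω).upper t ht.le
    · refine Eventually.of_forall fun ω => ?_
      have := (h ω).hasDerivWithinAt_zero
      rwa [hasDerivWithinAt_iff_tendsto_slope, Set.Ici_sdiff_left] at this
  refine key.congr' ?_
  filter_upwards [self_mem_nhdsWithin] with t ht
  simp only [slope_def_field, (h _).zero, sub_zero, integral_zero]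
  rw [integral_div]

theorem hasDerivAt_integral_gain (h : ∀ ω, IsGain (g ω) (L ω) (q ω)) (hL : Integrable L μ)
    (hm : ∀ t, 0 ≤ t → AEStronglyMeasurable (fun ω => g ω t) μ) {t : ℝ} (ht : 0 < t) :
    Integrable (fun ω => deriv (g ω) t) μ ∧
      HasDerivAt (fun t => ∫ ω, g ω t ∂μ) (∫ ω, deriv (g ω) t ∂μ) t := by
  refine hasDerivAt_integral_of_dominated_loc_of_deriv_le (F := fun t ω => g ω t)
    (F' := fun t ω => deriv (g ω) t) (bound := L) (Ioi_mem_nhds ht) ?_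
    (integrable_gain h hL hm ht.le) ?_ ?_ hL ?_
  · filter_upwards [lt_mem_nhds ht] with s hs using hm s hs.le
  -- The derivative is measurable in ω as a limit of difference quotients along a sequence.
  · have hu : Tendsto (fun k : ℕ => t + 1 / ((k : ℝ) + 1)) atTop (𝓝[>] t) := by
      refine tendsto_nhdsWithin_iff.2 ⟨?_, Eventually.of_forall fun k => ?_⟩
      · simpa using (tendsto_one_div_add_atTop_nhds_zero_nat (𝕜 := ℝ)).const_add t
      · rw [Set.mem_Ioi]
        have : (0 : ℝ) < 1 / ((k : ℝ) + 1) := by positivity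
        linarith
    refine aestronglyMeasurable_of_tendsto_ae (u := atTop)
      (f := fun (k : ℕ) ω => slope (g ω) t (t + 1 / ((k : ℝ) + 1))) ?_ ?_
    · intro k
      simp only [slope_def_field, div_eq_inv_mul]
      exact ((hm _ (by positivity)).sub (hm t ht.le)).const_mul _
    · refine Eventually.of_forall fun ω => ?_
      have h1 := ((h ω).diff t ht).hasDerivAt.hasDerivWithinAt (s := Set.Ioi t)
      rw [hasDerivWithinAt_iff_tendsto_slope' (by simp)] at h1
      exact h1.comp hu
  · refine Eventually.of_forall fun ω s hs => ?_
    rw [Real.norm_of_nonneg ((h ω).deriv_nonneg hs)]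
    exact (h ω).deriv_le hs
  · exact Eventually.of_forall fun ω s hs => ((h ω).diff s hs).hasDerivAt

theorem hasSecondDerivWithinAt_integral_gain (h : ∀ ω, IsGain (g ω) (L ω) (q ω))
    (hL : Integrable L μ) (hm : ∀ t, 0 ≤ t → AEStronglyMeasurable (fun ω => g ω t) μ)
    (hq : ∀ ω, ∀ ε > 0, ∀ᶠ t in 𝓝[>] (0:ℝ), g ω t ≤ L ω * t - (q ω - ε) * t ^ 2 / 2)
    (hqi : Integrable q μ) :
    HasSecondDerivWithinAt (fun t => ∫ ω, g ω t ∂μ) (-∫ ω, q ω ∂μ) (Set.Ici 0) 0 := by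
  have hz := hasDerivWithinAt_integral_gain_zero h hL hm
  have hz' : derivWithin (fun t => ∫ ω, g ω t ∂μ) (Set.Ici 0) 0 = ∫ ω, L ω ∂μ :=
    hz.derivWithin (uniqueDiffOn_Ici 0 0 Set.self_mem_Ici)
  have hp' : ∀ t, 0 < t → derivWithin (fun t => ∫ ω, g ω t ∂μ) (Set.Ici 0) t =
      ∫ ω, deriv (g ω) t ∂μ := fun t ht =>
    (hasDerivAt_integral_gain h hL hm ht).2.hasDerivWithinAt.derivWithin
      (uniqueDiffOn_Ici 0 t ht.le)
  refine ⟨?_, ?_⟩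
  · filter_upwards [self_mem_nhdsWithin] with t ht
    rcases (Set.mem_Ici.1 ht).eq_or_lt with rfl | ht
    · exact hz.differentiableWithinAt
    · exact (hasDerivAt_integral_gain h hL hm ht).2.differentiableAt.differentiableWithinAt
  · rw [hasDerivWithinAt_iff_tendsto_slope, Set.Ici_sdiff_left]
    have key : Tendsto (fun t => ∫ ω, (deriv (g ω) t - L ω) / t ∂μ) (𝓝[>] 0)
        (𝓝 (∫ ω, -q ω ∂μ)) := by
      refine tendsto_integral_filter_of_dominated_convergence (fun ω => 2 * q ω) ?_ ?_
        (hqi.const_mul 2) ?_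
      · filter_upwards [self_mem_nhdsWithin] with t ht
        exact (((hasDerivAt_integral_gain h hL hm ht).1.sub hL).div_const t).aestronglyMeasurable
      · filter_upwards [self_mem_nhdsWithin] with t ht
        exact Eventually.of_forall fun ω => (h ω).abs_deriv_sub_div_le ht
      · exact Eventually.of_forall fun ω => (h ω).tendsto_deriv_sub_div (hq ω)
    rw [integral_neg] at key
    refine key.congr' ?_
    filter_upwards [self_mem_nhdsWithin] with t ht
    rw [slope_def_field, hz', hp' t ht, sub_zero, integral_div,
      integral_sub (hasDerivAt_integral_gain h hL hm ht).1 hL]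

end Integral

/-! ### Second-order expansion of the rate -/

section Expansion

variable {n m p : Type*} [Fintype n] [DecidableEq n] [Fintype m] [DecidableEq m]
  [Fintype p] [DecidableEq p]

/-- Minus the second-order coefficient of the secrecy rate in the direction `Q`. -/
def curvature (H : Matrix m n ℂ) (G : Matrix p n ℂ) (Q : Matrix n n ℂ) : ℝ :=
  (Hᴴ * H * Q * (Hᴴ * H * Q)).trace.re - (Gᴴ * G * Q * (Gᴴ * G * Q)).trace.re

theorem trace_mul_self_le_of_le {X Y : Matrix n n ℂ} (hX : X.PosSemidef) (hY : Y.PosSemidef)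
    (h : (Y - X).PosSemidef) : (X * X).trace.re ≤ (Y * Y).trace.re := by
  have h1 := trace_mul_re_nonneg h hY
  have h2 := trace_mul_re_nonneg hX h
  rw [Matrix.sub_mul, trace_sub, Complex.sub_re] at h1
  rw [Matrix.mul_sub, trace_sub, Complex.sub_re] at h2
  linarith

/-- On such Q the matrix H†H acts as G†G + ℓ, so the rate is exactly log det(1 + ℓE) with E the
error covariance of tQ. The bounds tQ − t²QG†GQ ⪯ E ⪯ tQ then hold for all t ≥ 0, with no remainder.
-/
theorem sub_curvature_le_nrate {H : Matrix m n ℂ} {G : Matrix p n ℂ} {Q : Matrix n n ℂ} {ℓ : ℝ}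
    (hℓ : 0 ≤ ℓ) (hQ : Q.PosSemidef) (htr : Q.trace.re = 1)
    (h : (Hᴴ * H - Gᴴ * G) * Q = ℓ • Q) {t : ℝ} (ht : 0 ≤ t) :
    ℓ * t - curvature H G Q * t ^ 2 / 2 ≤ nrate H G (t • Q) := by
  have hQt : (t • Q).PosSemidef := hQ.smul ht
  have hQH : Qᴴ = Q := hQ.1
  set D : Matrix n n ℂ := Real.sqrt ℓ • 1 with hDdef
  have hDH : Dᴴ = D := by rw [hDdef, conjTranspose_smul, conjTranspose_one]; simp
  have hDD : Dᴴ * D = ℓ • 1 := by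
    rw [hDH, hDdef, Matrix.smul_mul, Matrix.mul_smul, smul_smul, Real.mul_self_sqrt hℓ,
      Matrix.one_mul]
  have hAQ : Hᴴ * H * Q = Gᴴ * G * Q + ℓ • Q := by
    rw [← h, Matrix.sub_mul]; abel
  have hdet : (1 + H * (t • Q) * Hᴴ).det = (1 + (Gᴴ * G + Dᴴ * D) * (t • Q)).det := by
    rw [det_one_add_conj, hDD, Matrix.mul_smul, Matrix.mul_smul, hAQ, Matrix.add_mul,
      Matrix.smul_mul, Matrix.one_mul]
  have hE := posSemidef_errCov G hQt
  rw [det_one_add_add_mul G D hQt] at hdet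
  have hr : nrate H G (t • Q) = logDet (1 + D * errCov G (t • Q) * Dᴴ) := by
    rw [nrate, logDet_eq_add_of_det_eq (posDef_one_add_conj D hE) (posDef_one_add_conj G hQt) hdet]
    ring
  have e : D * errCov G (t • Q) * Dᴴ = ℓ • errCov G (t • Q) := by
    rw [hDH, hDdef, Matrix.smul_mul, Matrix.mul_smul, Matrix.smul_mul, smul_smul,
      Real.mul_self_sqrt hℓ, Matrix.one_mul, Matrix.mul_one]
  rw [hr, e]
  refine le_trans ?_ (trace_sub_le_logDet_one_add (hE.smul hℓ))
  have k1 := trace_re_nonneg (posSemidef_errCov_sub G hQt)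
  have k2 := trace_mul_self_le_of_le hE hQt (posSemidef_sub_errCov G hQt)
  simp only [Matrix.smul_mul, Matrix.mul_smul, trace_smul, trace_sub, Complex.sub_re,
    Complex.smul_re, smul_eq_mul, htr, smul_smul] at k1 k2 ⊢
  have k3 : (Q * Gᴴ * G * Q).trace = (Gᴴ * G * Q * Q).trace := by
    rw [Matrix.mul_assoc, Matrix.mul_assoc, trace_mul_comm, ← Matrix.mul_assoc]
  have k4 : curvature H G Q = 2 * ℓ * (Gᴴ * G * Q * Q).trace.re + ℓ ^ 2 * (Q * Q).trace.re := by
    have k5 : (Q * (Gᴴ * G * Q)).trace = (Gᴴ * G * Q * Q).trace := trace_mul_comm _ _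
    rw [curvature, hAQ]
    simp only [Matrix.mul_add, Matrix.add_mul (Gᴴ * G * Q), Matrix.smul_mul, Matrix.mul_smul,
      trace_smul, trace_add, Complex.add_re, Complex.smul_re, smul_eq_mul, k5]
    ring
  rw [k3] at k1
  rw [k4]
  have k6 := mul_le_mul_of_nonneg_left k2 (mul_self_nonneg ℓ)
  have k7 := mul_nonneg hℓ k1
  nlinarith

theorem trace_conj_eq (V : Matrix m n ℂ) (Q : Matrix n n ℂ) :
    (V * Q * Vᴴ).trace = (Vᴴ * V * Q).trace := by
  rw [trace_mul_comm, Matrix.mul_assoc]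

theorem trace_conj_mul_conj_eq (V : Matrix m n ℂ) (Q : Matrix n n ℂ) :
    (V * Q * Vᴴ * (V * Q * Vᴴ)).trace = (Vᴴ * V * Q * (Vᴴ * V * Q)).trace := by
  have h1 : V * Q * Vᴴ * (V * Q * Vᴴ) = (V * Q) * (Vᴴ * V * Q * Vᴴ) := by
    simp only [Matrix.mul_assoc]
  have h2 : Vᴴ * V * Q * (Vᴴ * V * Q) = (Vᴴ * V * Q * Vᴴ) * (V * Q) := by
    simp only [Matrix.mul_assoc]
  rw [h1, h2, trace_mul_comm]

theorem nrate_smul_le {H : Matrix m n ℂ} {G : Matrix p n ℂ} {Q : Matrix n n ℂ}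
    (hQ : Q.PosSemidef) {t : ℝ} (ht : 0 ≤ t) :
    nrate H G (t • Q) ≤ t * ((Hᴴ * H - Gᴴ * G) * Q).trace.re - t ^ 2 / 2 * curvature H G Q +
      t ^ 3 * ((Hᴴ * H * Q).trace.re ^ 3 / 3) := by
  have hQt : (t • Q).PosSemidef := hQ.smul ht
  have h1 := logDet_one_add_le_cubic (hQt.mul_mul_conjTranspose_same H)
  have h2 := trace_sub_le_logDet_one_add (hQt.mul_mul_conjTranspose_same G)
  simp only [trace_conj_eq, trace_conj_mul_conj_eq, Matrix.smul_mul, Matrix.mul_smul, smul_smul,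
    trace_smul, Complex.smul_re, smul_eq_mul] at h1 h2
  rw [nrate, curvature, Matrix.sub_mul, trace_sub, Complex.sub_re]
  simp only [Matrix.smul_mul, Matrix.mul_smul]
  have h3 : (t * (Hᴴ * H * Q).trace.re) ^ 3 / 3 = t ^ 3 * ((Hᴴ * H * Q).trace.re ^ 3 / 3) := by
    ring
  rw [h3] at h1
  nlinarith

theorem exists_uniform_expansion {X : Type*} [TopologicalSpace X] {S : Set X} (hS : IsCompact S)
    {φ w c : X → ℝ} (hφ : Continuous φ) (hw : Continuous w) (hc : Continuous c) {ℓ q : ℝ}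
    (hle : ∀ x ∈ S, φ x ≤ ℓ) (heq : ∀ x ∈ S, φ x = ℓ → q ≤ w x) {ε : ℝ} (hε : 0 < ε) :
    ∀ᶠ t in 𝓝[>] (0:ℝ), ∀ x ∈ S, t * φ x - t ^ 2 / 2 * w x + t ^ 3 * c x ≤
      ℓ * t - (q - ε) * t ^ 2 / 2 := by
  -- On the compact set where w is too small, φ stays strictly below ℓ; δ is the gap at its maximum
  -- there.
  obtain ⟨δ, hδ, hδw⟩ : ∃ δ > 0, ∀ x ∈ S, ℓ - δ < φ x → q - ε / 2 < w x := by
    have hS' : IsCompact (S ∩ {x | w x ≤ q - ε / 2}) :=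
      hS.inter_right (isClosed_le hw continuous_const)
    rcases (S ∩ {x | w x ≤ q - ε / 2}).eq_empty_or_nonempty with he | hne
    · refine ⟨1, one_pos, fun x hx _ => ?_⟩
      by_contra hcon
      exact (Set.eq_empty_iff_forall_notMem.1 he x) ⟨hx, not_lt.1 hcon⟩
    · obtain ⟨x₀, hx₀, hmax⟩ := hS'.exists_isMaxOn hne hφ.continuousOn
      have hlt : φ x₀ < ℓ := by
        refine lt_of_le_of_ne (hle x₀ hx₀.1) fun h => ?_
        have h1 := heq x₀ hx₀.1 h
        have h2 : w x₀ ≤ q - ε / 2 := hx₀.2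
        linarith
      refine ⟨ℓ - φ x₀, by linarith, fun x hx hlt' => ?_⟩
      by_contra hcon
      have := hmax (a := x) ⟨hx, not_lt.1 hcon⟩
      simp only at this
      have h3 : φ x ≤ φ x₀ := this
      linarith
  obtain ⟨W, hW⟩ := hS.exists_bound_of_continuousOn hw.continuousOn
  obtain ⟨C, hC⟩ := hS.exists_bound_of_continuousOn hc.continuousOn
  have ev : ∀ {f : ℝ → ℝ} {b : ℝ}, Continuous f → f 0 = 0 → 0 < b → ∀ᶠ t in 𝓝[>] (0:ℝ), f t < b :=
    fun hf h0 hb => nhdsWithin_le_nhds (hf.continuousAt.eventually (gt_mem_nhds (by rwa [h0])))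
  filter_upwards [self_mem_nhdsWithin,
    ev (f := fun t => t * (|W| / 2 + |q - ε| / 2) + t ^ 2 * |C|) (by fun_prop) (by simp) hδ,
    ev (f := fun t => t * |C|) (b := ε / 4) (by fun_prop) (by simp) (by positivity)]
    with t ht h1 h2 x hx
  rw [Set.mem_Ioi] at ht
  have w1 : -|W| ≤ w x := by
    have := (abs_le.1 (Real.norm_eq_abs (w x) ▸ hW x hx)).1
    linarith [le_abs_self W]
  have c1 : c x ≤ |C| := by
    have := (abs_le.1 (Real.norm_eq_abs (c x) ▸ hC x hx)).2
    linarith [le_abs_self C]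
  suffices hs : φ x - t / 2 * w x + t ^ 2 * c x ≤ ℓ - (q - ε) * t / 2 by
    have := mul_le_mul_of_nonneg_left hs ht.le
    nlinarith
  have c2 : t ^ 2 * c x ≤ t ^ 2 * |C| := by gcongr
  have q1 : (q - ε) * t ≤ |q - ε| * t := by gcongr; exact le_abs_self _
  have w2 : t / 2 * (-|W|) ≤ t / 2 * w x := by gcongr
  -- Near the maximal slope, w costs ε/4 and the cubic term another ε/4, each times t. Elsewhere the
  -- loss δ in slope outweighs both higher-order terms.
  by_cases hcase : ℓ - δ < φ x
  · have h3 := hδw x hx hcase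
    have h4 : t / 2 * (q - ε / 2) ≤ t / 2 * w x := by gcongr
    have h5 := hle x hx
    have h6 : t * (t * |C|) ≤ t * (ε / 4) := by gcongr
    nlinarith
  · have h3 : φ x ≤ ℓ - δ := not_lt.1 hcase
    nlinarith

theorem continuous_curvature (H : Matrix m n ℂ) (G : Matrix p n ℂ) :
    Continuous (curvature H G) := by
  unfold curvature
  refine Continuous.sub ?_ ?_ <;>
    exact Complex.continuous_re.comp (Continuous.matrix_trace (by fun_prop))

theorem gain_le_expansion {H : Matrix m n ℂ} {G : Matrix p n ℂ} {ℓ q : ℝ}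
    (hle : ∀ Q ∈ covSet n 1, ((Hᴴ * H - Gᴴ * G) * Q).trace.re ≤ ℓ)
    (heq : ∀ Q ∈ covSet n 1, ((Hᴴ * H - Gᴴ * G) * Q).trace.re = ℓ → q ≤ curvature H G Q)
    {ε : ℝ} (hε : 0 < ε) :
    ∀ᶠ t in 𝓝[>] (0:ℝ), gain H G t ≤ ℓ * t - (q - ε) * t ^ 2 / 2 := by
  have h := exists_uniform_expansion (isCompact_covSet (n := n) 1)
    (φ := fun Q => ((Hᴴ * H - Gᴴ * G) * Q).trace.re) (w := curvature H G)
    (c := fun Q => (Hᴴ * H * Q).trace.re ^ 3 / 3)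
    (Complex.continuous_re.comp (Continuous.matrix_trace (by fun_prop)))
    (continuous_curvature H G)
    (((Complex.continuous_re.comp (Continuous.matrix_trace (by fun_prop))).pow 3).div_const 3)
    hle heq hε
  filter_upwards [h, self_mem_nhdsWithin] with t h1 ht
  rw [Set.mem_Ioi] at ht
  obtain ⟨K, hK, e⟩ := exists_nrate_eq_gain H G ht.le
  have hQ : t⁻¹ • K ∈ covSet n 1 := by
    refine ⟨hK.1.smul (by positivity), ?_⟩
    rw [trace_smul, Complex.smul_re, smul_eq_mul, inv_mul_le_iff₀ ht, mul_one]
    exact hK.2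
  have h2 := nrate_smul_le (H := H) (G := G) hQ.1 ht.le
  rw [smul_inv_smul₀ ht.ne', e] at h2
  exact h2.trans (h1 _ hQ)

end Expansion

/-! ### Directions supported on the top eigenspace -/

section Eigenbasis

variable {nT nR nE : ℕ} {Nm Ne : ℝ} {Hm : Matrix (Fin nR) (Fin nT) ℂ}
  {He : Matrix (Fin nE) (Fin nT) ℂ}

/-- The channel to the eavesdropper, in the noise units of the main channel. -/
def scaledEve (Nm Ne : ℝ) (He : Matrix (Fin nE) (Fin nT) ℂ) : Matrix (Fin nE) (Fin nT) ℂ :=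
  Real.sqrt (Nm / Ne) • He

theorem conjTranspose_scaledEve : (scaledEve Nm Ne He)ᴴ = Real.sqrt (Nm / Ne) • Heᴴ := by
  rw [scaledEve, conjTranspose_smul]; simp

theorem gram_scaledEve (hNm : 0 < Nm) (hNe : 0 < Ne) :
    (scaledEve Nm Ne He)ᴴ * scaledEve Nm Ne He = (Nm / Ne) • (Heᴴ * He) := by
  rw [conjTranspose_scaledEve, scaledEve, Matrix.smul_mul, Matrix.mul_smul, smul_smul,
    Real.mul_self_sqrt (by positivity)]

theorem phi_eq (hNm : 0 < Nm) (hNe : 0 < Ne) :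
    Phi Nm Ne Hm He = Hmᴴ * Hm - (scaledEve Nm Ne He)ᴴ * scaledEve Nm Ne He := by
  rw [gram_scaledEve hNm hNe, Phi]
  congr 1

/-- The matrix whose columns are the vectors `u i`. -/
def basisMatrix {ι : Type*} (u : ι → EuclideanSpace ℂ (Fin nT)) : Matrix (Fin nT) ι ℂ :=
  of fun k i => u i k

theorem gramForm_eq {m : ℕ} {ι : Type*} (H : Matrix (Fin m) (Fin nT) ℂ)
    (u : ι → EuclideanSpace ℂ (Fin nT)) (i j : ι) :
    gramForm H (u j) (u i) = ((basisMatrix u)ᴴ * (Hᴴ * H) * basisMatrix u) j i := by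
  rw [Matrix.mul_assoc]; rfl

/-- The covariance `∑ i, α i u_i u_i†`. -/
def dirCov {ι : Type*} [Fintype ι] [DecidableEq ι] (u : ι → EuclideanSpace ℂ (Fin nT)) (α : ι → ℝ) :
    Matrix (Fin nT) (Fin nT) ℂ :=
  basisMatrix u * diagonal (fun i => (α i : ℂ)) * (basisMatrix u)ᴴ

theorem trace_gram_dirCov {m l : ℕ} (H : Matrix (Fin m) (Fin nT) ℂ)
    (u : Fin l → EuclideanSpace ℂ (Fin nT)) (α : Fin l → ℝ) :
    (Hᴴ * H * dirCov u α * (Hᴴ * H * dirCov u α)).trace.re =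
      ∑ i, ∑ j, α i * α j * ‖gramForm H (u j) (u i)‖ ^ 2 := by
  simp only [gramForm_eq]
  set V := basisMatrix u with hV
  set D : Matrix (Fin l) (Fin l) ℂ := diagonal (fun i => (α i : ℂ)) with hD
  set M := Vᴴ * (Hᴴ * H) * V with hM
  have hMH : Mᴴ = M := ((posSemidef_conjTranspose_mul_self H).conjTranspose_mul_mul_same V).1
  have e : (Hᴴ * H * dirCov u α * (Hᴴ * H * dirCov u α)).trace = (M * D * (M * D)).trace := by
    have h1 : Hᴴ * H * dirCov u α * (Hᴴ * H * dirCov u α) =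
        (Hᴴ * H * V * D * Vᴴ * (Hᴴ * H) * V * D) * Vᴴ := by
      rw [dirCov]; simp only [Matrix.mul_assoc, ← hV, ← hD]
    rw [h1, trace_mul_comm, hM]
    simp only [Matrix.mul_assoc]
  have h5 : ∀ i j, (M * D) i j = M i j * (α j : ℂ) := fun i j => Matrix.mul_diagonal _ _ _ _
  have h6 : (M * D * (M * D)).trace = ∑ j, ∑ i, (M * D) j i * (M * D) i j := rfl
  rw [e, h6, Finset.sum_comm]
  simp only [h5, Complex.re_sum]
  refine Finset.sum_congr rfl fun i _ => Finset.sum_congr rfl fun j _ => ?_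
  have h2 : M i j = star (M j i) := by
    conv_lhs => rw [← hMH]
    rfl
  have h3 : M j i * (starRingEnd ℂ) (M j i) = ((‖M j i‖ ^ 2 : ℝ) : ℂ) := by
    rw [Complex.mul_conj, Complex.normSq_eq_norm_sq]
  have h4 : M j i * (α i : ℂ) * (M i j * (α j : ℂ)) =
      ((α i * α j * ‖M j i‖ ^ 2 : ℝ) : ℂ) := by
    rw [h2]
    change M j i * (α i : ℂ) * ((starRingEnd ℂ) (M j i) * (α j : ℂ)) = _
    rw [Complex.ofReal_mul _ (‖M j i‖ ^ 2), ← h3]; push_cast; ring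
  rw [h4, Complex.ofReal_re]

theorem quadForm_eq_curvature (hNm : 0 < Nm) (hNe : 0 < Ne) {l : ℕ}
    (u : Fin l → EuclideanSpace ℂ (Fin nT)) (α : Fin l → ℝ) :
    quadForm Nm Ne Hm He u α = curvature Hm (scaledEve Nm Ne He) (dirCov u α) := by
  rw [curvature, trace_gram_dirCov, trace_gram_dirCov, quadForm]
  simp only [← Finset.sum_sub_distrib]
  refine Finset.sum_congr rfl fun i _ => Finset.sum_congr rfl fun j _ => ?_
  have : gramForm (scaledEve Nm Ne He) (u j) (u i) = (Nm / Ne : ℝ) • gramForm He (u j) (u i) := by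
    rw [gramForm_eq, gramForm_eq, gram_scaledEve hNm hNe, Matrix.mul_smul, Matrix.smul_mul]
    rfl
  rw [this, norm_smul, mul_pow, Real.norm_eq_abs, sq_abs, div_pow]
  ring

theorem mem_maxEigenspace_iff {x : EuclideanSpace ℂ (Fin nT)} :
    x ∈ maxEigenspace Nm Ne Hm He ↔
      Phi Nm Ne Hm He *ᵥ x.ofLp = (lambdaMax Nm Ne Hm He) • x.ofLp := by
  rw [maxEigenspace, Module.End.mem_eigenspace_iff]
  constructor
  · intro h
    have := congrArg WithLp.ofLp h
    ext i
    simpa using congrFun this i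
  · intro h
    ext i
    simpa using congrFun h i

theorem orthonormal_iff_basisMatrix {ι : Type*} [Fintype ι] [DecidableEq ι]
    {u : ι → EuclideanSpace ℂ (Fin nT)} :
    Orthonormal ℂ u ↔ (basisMatrix u)ᴴ * basisMatrix u = 1 := by
  rw [orthonormal_iff_ite, ← Matrix.ext_iff]
  refine forall_congr' fun i => forall_congr' fun j => ?_
  rw [EuclideanSpace.inner_eq_star_dotProduct, dotProduct_comm, Matrix.one_apply]
  rfl

theorem phi_mul_basisMatrix {ι : Type*} {u : ι → EuclideanSpace ℂ (Fin nT)} :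
    (∀ i, u i ∈ maxEigenspace Nm Ne Hm He) ↔
      Phi Nm Ne Hm He * basisMatrix u = lambdaMax Nm Ne Hm He • basisMatrix u := by
  simp only [mem_maxEigenspace_iff]
  constructor
  · intro h; ext k i; exact congrFun (h i) k
  · intro h i; ext k; exact congrFun (congrFun h k) i

theorem isMaxEigenbasis_of_orthonormal
    {u : Fin (multiplicity Nm Ne Hm He) → EuclideanSpace ℂ (Fin nT)}
    (hu : Orthonormal ℂ u) (hmem : ∀ i, u i ∈ maxEigenspace Nm Ne Hm He) :
    IsMaxEigenbasis Nm Ne Hm He u := by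
  refine ⟨hu, Submodule.eq_of_le_of_finrank_eq ?_ ?_⟩
  · rw [Submodule.span_le]
    rintro _ ⟨i, rfl⟩
    exact hmem i
  · rw [finrank_span_eq_card hu.linearIndependent, Fintype.card_fin]
    rfl

theorem IsMaxEigenbasis.mem {u : Fin (multiplicity Nm Ne Hm He) → EuclideanSpace ℂ (Fin nT)}
    (hu : IsMaxEigenbasis Nm Ne Hm He u) (i) : u i ∈ maxEigenspace Nm Ne Hm He := by
  rw [← hu.2]; exact Submodule.subset_span ⟨i, rfl⟩

theorem exists_isMaxEigenbasis :
    ∃ u, IsMaxEigenbasis Nm Ne Hm He u := by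
  let b := stdOrthonormalBasis ℂ (maxEigenspace Nm Ne Hm He)
  refine ⟨fun i => (b i : EuclideanSpace ℂ (Fin nT)), isMaxEigenbasis_of_orthonormal ?_
    fun i => (b i).2⟩
  exact b.orthonormal.comp_linearIsometry (maxEigenspace Nm Ne Hm He).subtypeₗᵢ

theorem IsMaxEigenbasis.proj_mul
    {u : Fin (multiplicity Nm Ne Hm He) → EuclideanSpace ℂ (Fin nT)}
    (hu : IsMaxEigenbasis Nm Ne Hm He u) {Q : Matrix (Fin nT) (Fin nT) ℂ}
    (hQ : Phi Nm Ne Hm He * Q = lambdaMax Nm Ne Hm He • Q) :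
    basisMatrix u * (basisMatrix u)ᴴ * Q = Q := by
  have h1 : ∀ k, ∃ c : Fin (multiplicity Nm Ne Hm He) → ℂ,
      ∑ i, c i • u i = WithLp.toLp 2 (fun r => Q r k) := by
    intro k
    rw [← Submodule.mem_span_range_iff_exists_fun, hu.2, mem_maxEigenspace_iff]
    ext r
    exact congrFun (congrFun hQ r) k
  choose c hc using h1
  have h2 : Q = basisMatrix u * of fun i k => c k i := by
    ext r k
    have := congrFun (congrArg WithLp.ofLp (hc k)) r
    simp only [WithLp.ofLp_sum, Finset.sum_apply, WithLp.ofLp_smul, Pi.smul_apply,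
      smul_eq_mul] at this
    rw [← this, Matrix.mul_apply]
    exact Finset.sum_congr rfl fun i _ => mul_comm _ _
  have h3 := orthonormal_iff_basisMatrix.1 hu.1
  rw [h2, Matrix.mul_assoc, ← Matrix.mul_assoc _ (basisMatrix u), h3, Matrix.one_mul]

theorem IsMaxEigenbasis.proj_mul_proj
    {u : Fin (multiplicity Nm Ne Hm He) → EuclideanSpace ℂ (Fin nT)}
    (hu : IsMaxEigenbasis Nm Ne Hm He u) {Q : Matrix (Fin nT) (Fin nT) ℂ}
    (hQ : Phi Nm Ne Hm He * Q = lambdaMax Nm Ne Hm He • Q) (hQH : Q.IsHermitian) :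
    Q = basisMatrix u * ((basisMatrix u)ᴴ * Q * basisMatrix u) * (basisMatrix u)ᴴ := by
  have h1 := hu.proj_mul hQ
  have h2 : Q * (basisMatrix u * (basisMatrix u)ᴴ) = Q := by
    have := congrArg Matrix.conjTranspose h1
    simpa only [conjTranspose_mul, conjTranspose_conjTranspose, hQH.eq] using this
  calc Q = basisMatrix u * (basisMatrix u)ᴴ * Q * (basisMatrix u * (basisMatrix u)ᴴ) := by
        rw [h1, h2]
    _ = _ := by simp only [Matrix.mul_assoc]

/-- Compressing Q to the eigenspace and diagonalizing there rotates an arbitrary eigenbasis into one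
that diagonalizes Q. Thus minimizing over bases and weights covers every admissible direction. -/
theorem exists_dirCov_eq {Q : Matrix (Fin nT) (Fin nT) ℂ} (hQp : Q.PosSemidef)
    (hQ : Phi Nm Ne Hm He * Q = lambdaMax Nm Ne Hm He • Q) :
    ∃ u α, IsMaxEigenbasis Nm Ne Hm He u ∧ (∀ i, 0 ≤ α i) ∧ Q = dirCov u α := by
  obtain ⟨v, hv⟩ := exists_isMaxEigenbasis (Nm := Nm) (Ne := Ne) (Hm := Hm) (He := He)
  have hR := hQp.conjTranspose_mul_mul_same (basisMatrix v)
  obtain ⟨U, hU, hU', h⟩ := exists_unitary_diagonal hR.1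
  have hb : basisMatrix (fun i => WithLp.toLp 2 (fun k => (basisMatrix v * U) k i)) =
      basisMatrix v * U := rfl
  refine ⟨fun i => WithLp.toLp 2 (fun k => (basisMatrix v * U) k i), hR.1.eigenvalues,
    isMaxEigenbasis_of_orthonormal ?_ ?_, hR.eigenvalues_nonneg, ?_⟩
  · rw [orthonormal_iff_basisMatrix, hb, conjTranspose_mul, Matrix.mul_assoc,
      ← Matrix.mul_assoc _ _ U, orthonormal_iff_basisMatrix.1 hv.1, Matrix.one_mul, hU]
  · rw [phi_mul_basisMatrix, hb, ← Matrix.mul_assoc, phi_mul_basisMatrix.1 hv.mem,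
      Matrix.smul_mul]
  · rw [dirCov, hb]
    conv_lhs => rw [hv.proj_mul_proj hQ hQp.1, h]
    simp only [conjTranspose_mul, Matrix.mul_assoc]

theorem posSemidef_dirCov {l : ℕ} (u : Fin l → EuclideanSpace ℂ (Fin nT)) {α : Fin l → ℝ}
    (hα : ∀ i, 0 ≤ α i) : (dirCov u α).PosSemidef := by
  refine PosSemidef.mul_mul_conjTranspose_same (PosSemidef.diagonal fun i => ?_) _
  exact Complex.zero_le_real.2 (hα i)

theorem trace_dirCov {l : ℕ} {u : Fin l → EuclideanSpace ℂ (Fin nT)} (hu : Orthonormal ℂ u)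
    (α : Fin l → ℝ) : (dirCov u α).trace.re = ∑ i, α i := by
  rw [dirCov, trace_conj_eq, orthonormal_iff_basisMatrix.1 hu, Matrix.one_mul, trace_diagonal]
  simp

theorem phi_mul_dirCov {u : Fin (multiplicity Nm Ne Hm He) → EuclideanSpace ℂ (Fin nT)}
    (hu : IsMaxEigenbasis Nm Ne Hm He u) (α : Fin (multiplicity Nm Ne Hm He) → ℝ) :
    Phi Nm Ne Hm He * dirCov u α = lambdaMax Nm Ne Hm He • dirCov u α := by
  rw [dirCov, ← Matrix.mul_assoc, ← Matrix.mul_assoc, phi_mul_basisMatrix.1 hu.mem,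
    Matrix.smul_mul, Matrix.smul_mul]

theorem posSemidef_smul_one_sub_phi {ℓ : ℝ} (hℓ : lambdaMax Nm Ne Hm He ≤ ℓ) :
    (ℓ • (1 : Matrix (Fin nT) (Fin nT) ℂ) - Phi Nm Ne Hm He).PosSemidef := by
  have hH := phi_isHermitian Nm Ne Hm He
  obtain ⟨U, hU, hU', h⟩ := exists_unitary_diagonal hH
  have e : ℓ • (1 : Matrix (Fin nT) (Fin nT) ℂ) - Phi Nm Ne Hm He =
      U * diagonal (fun i => ((ℓ - hH.eigenvalues i : ℝ) : ℂ)) * Uᴴ := by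
    have h2 : (diagonal fun i => ((ℓ - hH.eigenvalues i : ℝ) : ℂ))
        = ℓ • 1 - diagonal (fun i => (hH.eigenvalues i : ℂ)) := by
      rw [← diagonal_one, ← diagonal_smul, diagonal_sub]; simp
    rw [h2, Matrix.mul_sub, Matrix.sub_mul, Matrix.mul_smul, Matrix.smul_mul, Matrix.mul_one,
      hU', ← h]
  rw [e]
  refine PosSemidef.mul_mul_conjTranspose_same (PosSemidef.diagonal fun i => ?_) _
  refine Complex.zero_le_real.2 (sub_nonneg.2 (le_trans ?_ hℓ))
  exact le_ciSup (Set.finite_range _).bddAbove i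

theorem multiplicity_pos (hT : 0 < nT) : 0 < multiplicity Nm Ne Hm He := by
  have : Nonempty (Fin nT) := ⟨⟨0, hT⟩⟩
  have hH := phi_isHermitian Nm Ne Hm He
  obtain ⟨i, hi⟩ := exists_eq_ciSup_of_finite (f := hH.eigenvalues)
  have hmem : hH.eigenvectorBasis i ∈ maxEigenspace Nm Ne Hm He := by
    rw [mem_maxEigenspace_iff, hH.mulVec_eigenvectorBasis i, lambdaMax, hi]
  have hne : hH.eigenvectorBasis i ≠ 0 := hH.eigenvectorBasis.orthonormal.ne_zero i
  rw [multiplicity, Module.finrank_pos_iff]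
  exact ⟨⟨⟨_, hmem⟩, 0, fun h => hne (congrArg Subtype.val h)⟩⟩

theorem stdSimplex_nonempty (hT : 0 < nT) :
    (stdSimplex ℝ (Fin (multiplicity Nm Ne Hm He))).Nonempty :=
  ⟨_, single_mem_stdSimplex ℝ (⟨0, multiplicity_pos hT⟩ : Fin (multiplicity Nm Ne Hm He))⟩

/-- The equality case of tr(ΦQ) ≤ λ_max: positivity of λ_max forces full power, and two positive
semidefinite matrices with traceless product have product zero. -/
theorem phi_mul_eq_of_trace_ge (hpos : 0 < lambdaMax Nm Ne Hm He)
    {Q : Matrix (Fin nT) (Fin nT) ℂ} (hQ : Q ∈ covSet (Fin nT) 1)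
    (h : lambdaMax Nm Ne Hm He ≤ (Phi Nm Ne Hm He * Q).trace.re) :
    Q.trace.re = 1 ∧ Phi Nm Ne Hm He * Q = lambdaMax Nm Ne Hm He • Q := by
  have hp := posSemidef_smul_one_sub_phi (le_refl (lambdaMax Nm Ne Hm He))
  have h1 := trace_mul_re_nonneg hp hQ.1
  have e : ((lambdaMax Nm Ne Hm He • (1 : Matrix (Fin nT) (Fin nT) ℂ) - Phi Nm Ne Hm He) *
      Q).trace.re = lambdaMax Nm Ne Hm He * Q.trace.re - (Phi Nm Ne Hm He * Q).trace.re := by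
    rw [Matrix.sub_mul, Matrix.smul_mul, Matrix.one_mul, trace_sub, trace_smul, Complex.sub_re,
      Complex.smul_re, smul_eq_mul]
  have h2 : Q.trace.re ≤ 1 := hQ.2
  have htr : Q.trace.re = 1 := by
    refine le_antisymm h2 ?_
    rw [e] at h1
    by_contra hcon
    push Not at hcon
    nlinarith
  refine ⟨htr, ?_⟩
  have h0 : ((lambdaMax Nm Ne Hm He • (1 : Matrix (Fin nT) (Fin nT) ℂ) - Phi Nm Ne Hm He) *
      Q).trace.re = 0 := by
    refine le_antisymm ?_ h1
    rw [e, htr]; linarith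
  obtain ⟨D, -, hD⟩ := exists_eq_conjTranspose_mul_self hp
  obtain ⟨k, -, hk⟩ := exists_eq_conjTranspose_mul_self hQ.1
  have h3 : ((D * kᴴ) * (D * kᴴ)ᴴ).trace = 0 := by
    have hps := (posSemidef_self_mul_conjTranspose (D * kᴴ))
    have e3 : ((D * kᴴ) * (D * kᴴ)ᴴ).trace = (Dᴴ * D * (kᴴ * k)).trace := by
      rw [conjTranspose_mul, conjTranspose_conjTranspose, ← Matrix.mul_assoc, trace_mul_comm]
      simp only [Matrix.mul_assoc]
    apply Complex.ext
    · rw [e3, ← hD, ← hk, h0]; rfl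
    · exact (Complex.nonneg_iff.1 hps.trace_nonneg).2.symm
  have h4 : D * kᴴ = 0 := trace_mul_conjTranspose_self_eq_zero_iff.1 h3
  have h5 : (lambdaMax Nm Ne Hm He • (1 : Matrix (Fin nT) (Fin nT) ℂ) - Phi Nm Ne Hm He) * Q
      = 0 := by
    rw [hD]
    nth_rw 1 [hk]
    rw [Matrix.mul_assoc, ← Matrix.mul_assoc D, h4]; simp
  rw [Matrix.sub_mul, Matrix.smul_mul, Matrix.one_mul, sub_eq_zero] at h5
  exact h5.symm

end Eigenbasis

/-! ### The curvature in a diagonalizing basis -/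

section Pinching

variable {n m p ι : Type*} [Fintype n] [DecidableEq n] [Fintype m] [DecidableEq m]
  [Fintype p] [DecidableEq p] [Fintype ι] [DecidableEq ι]

theorem trace_gram_conj_eq_sum {H : Matrix m n ℂ} {V : Matrix n ι ℂ} {R : Matrix ι ι ℂ}
    (hR : R.IsHermitian) {a : ι → ℝ} (ha : Vᴴ * (Hᴴ * H) * V = diagonal (fun i => (a i : ℂ))) :
    (Hᴴ * H * (V * R * Vᴴ) * (Hᴴ * H * (V * R * Vᴴ))).trace.re =
      ∑ i, ∑ j, a i * a j * ‖R i j‖ ^ 2 := by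
  set D : Matrix ι ι ℂ := diagonal (fun i => (a i : ℂ))
  have h1 : Hᴴ * H * (V * R * Vᴴ) * (Hᴴ * H * (V * R * Vᴴ)) =
      (Hᴴ * H * V * R * Vᴴ * (Hᴴ * H) * V * R) * Vᴴ := by
    simp only [Matrix.mul_assoc]
  have h2 : (Hᴴ * H * (V * R * Vᴴ) * (Hᴴ * H * (V * R * Vᴴ))).trace = (D * R * (D * R)).trace := by
    rw [h1, trace_mul_comm, ← ha]
    simp only [Matrix.mul_assoc]
  have h3 : ∀ i j, (D * R) i j = (a i : ℂ) * R i j := fun i j => Matrix.diagonal_mul _ _ _ _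
  have h4 : (D * R * (D * R)).trace = ∑ i, ∑ j, (D * R) i j * (D * R) j i := rfl
  rw [h2, h4]
  simp only [h3, Complex.re_sum]
  refine Finset.sum_congr rfl fun i _ => Finset.sum_congr rfl fun j _ => ?_
  have h5 : R j i = (starRingEnd ℂ) (R i j) := by
    conv_lhs => rw [← hR.eq]
    rfl
  have h6 : (a i : ℂ) * R i j * ((a j : ℂ) * R j i) = ((a i * a j * ‖R i j‖ ^ 2 : ℝ) : ℂ) := by
    rw [h5, ← Complex.normSq_eq_norm_sq]
    push_cast
    rw [← Complex.mul_conj]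
    ring
  rw [h6, Complex.ofReal_re]

theorem curvature_conj_eq_sum {H : Matrix m n ℂ} {G : Matrix p n ℂ} {V : Matrix n ι ℂ}
    {R : Matrix ι ι ℂ} (hR : R.IsHermitian) {a b : ι → ℝ}
    (ha : Vᴴ * (Hᴴ * H) * V = diagonal (fun i => (a i : ℂ)))
    (hb : Vᴴ * (Gᴴ * G) * V = diagonal (fun i => (b i : ℂ))) :
    curvature H G (V * R * Vᴴ) = ∑ i, ∑ j, (a i * a j - b i * b j) * ‖R i j‖ ^ 2 := by
  rw [curvature, trace_gram_conj_eq_sum hR ha, trace_gram_conj_eq_sum hR hb]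
  simp only [← Finset.sum_sub_distrib, sub_mul]

end Pinching

/-! ### The expansion for a fixed realization -/

section Pointwise

variable {nT nR nE : ℕ} {Nm Ne : ℝ} {Hm : Matrix (Fin nR) (Fin nT) ℂ}
  {He : Matrix (Fin nE) (Fin nT) ℂ}

/-- The weights are the diagonal of Q in the basis u. The curvature is a combination of the squared
moduli of the entries of Q with nonnegative coefficients, so dropping the off-diagonal ones cannot
increase it. -/
theorem exists_quadForm_le_curvature (hNm : 0 < Nm) (hNe : 0 < Ne)
    (hpos : 0 < lambdaMax Nm Ne Hm He)
    {u : Fin (multiplicity Nm Ne Hm He) → EuclideanSpace ℂ (Fin nT)}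
    (hu : IsMaxEigenbasis Nm Ne Hm He u)
    (hd : ∀ i j, i ≠ j → gramForm Hm (u j) (u i) = 0)
    {Q : Matrix (Fin nT) (Fin nT) ℂ} (hQp : Q.PosSemidef) (htr : Q.trace.re = 1)
    (hQ : Phi Nm Ne Hm He * Q = lambdaMax Nm Ne Hm He • Q) :
    ∃ α ∈ stdSimplex ℝ (Fin (multiplicity Nm Ne Hm He)),
      quadForm Nm Ne Hm He u α ≤ curvature Hm (scaledEve Nm Ne He) Q := by
  set ℓ := lambdaMax Nm Ne Hm He with hℓ
  set G := scaledEve Nm Ne He with hG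
  have hV := orthonormal_iff_basisMatrix.1 hu.1
  have hPV := phi_mul_basisMatrix.1 hu.mem
  have hQV := hu.proj_mul_proj hQ hQp.1
  have hgram := fun i j => gramForm_eq Hm u i j
  have hphi : Phi Nm Ne Hm He = Hmᴴ * Hm - Gᴴ * G := phi_eq hNm hNe
  set V := basisMatrix u with hVdef
  have hR := hQp.conjTranspose_mul_mul_same V
  set R := Vᴴ * Q * V with hRdef
  have hM := (posSemidef_conjTranspose_mul_self Hm).conjTranspose_mul_mul_same V
  have hN := (posSemidef_conjTranspose_mul_self G).conjTranspose_mul_mul_same V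
  set a := fun i => ((Vᴴ * (Hmᴴ * Hm) * V) i i).re with ha
  have haM : Vᴴ * (Hmᴴ * Hm) * V = diagonal (fun i => (a i : ℂ)) := by
    ext i j
    by_cases hij : i = j
    · subst hij
      rw [diagonal_apply_eq]
      refine Complex.ext rfl ?_
      simpa using (Complex.nonneg_iff.1 (hM.diag_nonneg (i := i))).2.symm
    · rw [diagonal_apply_ne _ hij, ← hgram, hd j i fun h => hij h.symm]
  -- On the eigenspace the two Gram forms differ by ℓ times the identity, so diagonalizing one
  -- diagonalizes the other.
  have hbN : Vᴴ * (Gᴴ * G) * V = diagonal (fun i => ((a i - ℓ : ℝ) : ℂ)) := by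
    have h1 : Gᴴ * G = Hmᴴ * Hm - Phi Nm Ne Hm He := by rw [hphi]; abel
    rw [h1, Matrix.mul_sub, Matrix.sub_mul, haM, Matrix.mul_assoc Vᴴ (Phi Nm Ne Hm He), hPV,
      Matrix.mul_smul, hV, ← diagonal_one, ← diagonal_smul, diagonal_sub]
    congr 1; ext i; simp [hℓ]
  have hb : ∀ i, 0 ≤ a i - ℓ := by
    intro i
    have := (Complex.nonneg_iff.1 (hN.diag_nonneg (i := i))).1
    rw [hbN, diagonal_apply_eq, Complex.ofReal_re] at this
    exact this
  refine ⟨fun i => (R i i).re, ⟨fun i => (Complex.nonneg_iff.1 hR.diag_nonneg).1, ?_⟩, ?_⟩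
  · have h1 : R.trace = Q.trace := by
      rw [hQV, trace_conj_eq, hV, Matrix.one_mul]
    have h2 : R.trace.re = ∑ i, (R i i).re := by
      simp only [trace, diag_apply, Complex.re_sum]
    rw [← h2, h1, htr]
  · have hDH : (diagonal (fun i => ((R i i).re : ℂ))).IsHermitian := by
      rw [IsHermitian, diagonal_conjTranspose]
      congr 1; ext i; simp
    rw [quadForm_eq_curvature hNm hNe, dirCov, ← hVdef, ← hG, curvature_conj_eq_sum hDH haM hbN,
      hQV, curvature_conj_eq_sum hR.1 haM hbN]
    refine Finset.sum_le_sum fun i _ => Finset.sum_le_sum fun j _ => ?_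
    have hc : 0 ≤ a i * a j - (a i - ℓ) * (a j - ℓ) := by
      have : a i * a j - (a i - ℓ) * (a j - ℓ) = ℓ * ((a i - ℓ) + (a j - ℓ) + ℓ) := by ring
      rw [this]
      have h1 := hb i
      have h2 := hb j
      positivity
    refine mul_le_mul_of_nonneg_left ?_ hc
    by_cases hij : i = j
    · subst hij
      rw [diagonal_apply_eq, Complex.norm_real]
      exact pow_le_pow_left₀ (norm_nonneg _) (Complex.abs_re_le_norm _) 2
    · rw [diagonal_apply_ne _ hij]; simp

theorem sub_quadForm_le_gain (hNm : 0 < Nm) (hNe : 0 < Ne) (hpos : 0 < lambdaMax Nm Ne Hm He)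
    {u : Fin (multiplicity Nm Ne Hm He) → EuclideanSpace ℂ (Fin nT)}
    (hu : IsMaxEigenbasis Nm Ne Hm He u) {α : Fin (multiplicity Nm Ne Hm He) → ℝ}
    (hα : α ∈ stdSimplex ℝ (Fin (multiplicity Nm Ne Hm He))) {t : ℝ} (ht : 0 ≤ t) :
    lambdaMax Nm Ne Hm He * t - quadForm Nm Ne Hm He u α * t ^ 2 / 2 ≤
      gain Hm (scaledEve Nm Ne He) t := by
  have hp := posSemidef_dirCov u hα.1
  have htr : (dirCov u α).trace.re = 1 := by rw [trace_dirCov hu.1, hα.2]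
  have hphi := phi_mul_dirCov hu α
  rw [phi_eq hNm hNe] at hphi
  rw [quadForm_eq_curvature hNm hNe]
  refine (sub_curvature_le_nrate hpos.le hp htr hphi ht).trans (nrate_le_gain _ _ ⟨hp.smul ht, ?_⟩)
  rw [trace_smul, Complex.smul_re, htr, smul_eq_mul, mul_one]

/-- The gain itself bounds the quadratic forms from below. At one t this makes the infimum
meaningful; at every t it passes the lower bound on the gain to the infimum without showing that it
is attained. -/
theorem lower_bound_mem (hNm : 0 < Nm) (hNe : 0 < Ne) (hpos : 0 < lambdaMax Nm Ne Hm He)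
    {t : ℝ} (ht : 0 < t) : 2 * (lambdaMax Nm Ne Hm He * t - gain Hm (scaledEve Nm Ne He) t) / t ^ 2 ∈
      lowerBounds {x | ∃ u, IsMaxEigenbasis Nm Ne Hm He u ∧
        ∃ α ∈ stdSimplex ℝ (Fin (multiplicity Nm Ne Hm He)), x = quadForm Nm Ne Hm He u α} := by
  rintro x ⟨u, hu, α, hα, rfl⟩
  have := sub_quadForm_le_gain hNm hNe hpos hu hα ht.le
  rw [div_le_iff₀ (by positivity)]
  linarith

theorem minWeightsBases_le (hNm : 0 < Nm) (hNe : 0 < Ne) (hpos : 0 < lambdaMax Nm Ne Hm He)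
    {u : Fin (multiplicity Nm Ne Hm He) → EuclideanSpace ℂ (Fin nT)}
    (hu : IsMaxEigenbasis Nm Ne Hm He u) {α : Fin (multiplicity Nm Ne Hm He) → ℝ}
    (hα : α ∈ stdSimplex ℝ (Fin (multiplicity Nm Ne Hm He))) :
    minWeightsBases Nm Ne Hm He ≤ quadForm Nm Ne Hm He u α :=
  csInf_le ⟨_, lower_bound_mem hNm hNe hpos one_pos⟩ ⟨u, hu, α, hα, rfl⟩

theorem minWeightsBases_lower (hT : 0 < nT) (hNm : 0 < Nm) (hNe : 0 < Ne)
    (hpos : 0 < lambdaMax Nm Ne Hm He) {t : ℝ} (ht : 0 ≤ t) :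
    lambdaMax Nm Ne Hm He * t - minWeightsBases Nm Ne Hm He * t ^ 2 / 2 ≤
      gain Hm (scaledEve Nm Ne He) t := by
  rcases ht.eq_or_lt with rfl | ht
  · simp [gain_zero]
  obtain ⟨u, hu⟩ := exists_isMaxEigenbasis (Nm := Nm) (Ne := Ne) (Hm := Hm) (He := He)
  obtain ⟨α, hα⟩ := stdSimplex_nonempty (Nm := Nm) (Ne := Ne) (Hm := Hm) (He := He) hT
  have h1 : 2 * (lambdaMax Nm Ne Hm He * t - gain Hm (scaledEve Nm Ne He) t) / t ^ 2 ≤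
      minWeightsBases Nm Ne Hm He :=
    le_csInf ⟨quadForm Nm Ne Hm He u α, u, hu, α, hα, rfl⟩ (lower_bound_mem hNm hNe hpos ht)
  rw [div_le_iff₀ (by positivity)] at h1
  linarith

theorem trace_phi_mul_le {ℓ : ℝ} (h : lambdaMax Nm Ne Hm He ≤ ℓ) (hℓ : 0 ≤ ℓ)
    {Q : Matrix (Fin nT) (Fin nT) ℂ} (hQ : Q ∈ covSet (Fin nT) 1) :
    (Phi Nm Ne Hm He * Q).trace.re ≤ ℓ := by
  have h1 := trace_mul_re_nonneg (posSemidef_smul_one_sub_phi h) hQ.1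
  rw [Matrix.sub_mul, Matrix.smul_mul, Matrix.one_mul, trace_sub, trace_smul, Complex.sub_re,
      Complex.smul_re, smul_eq_mul] at h1
  have h2 : Q.trace.re ≤ 1 := hQ.2
  nlinarith

theorem minWeightsBases_upper (hNm : 0 < Nm) (hNe : 0 < Ne)
    (hpos : 0 < lambdaMax Nm Ne Hm He) {ε : ℝ} (hε : 0 < ε) :
    ∀ᶠ t in 𝓝[>] (0:ℝ), gain Hm (scaledEve Nm Ne He) t ≤
      lambdaMax Nm Ne Hm He * t - (minWeightsBases Nm Ne Hm He - ε) * t ^ 2 / 2 := by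
  refine gain_le_expansion ?_ ?_ hε
  · intro Q hQ
    rw [← phi_eq hNm hNe]
    exact trace_phi_mul_le le_rfl hpos.le hQ
  · intro Q hQ he
    rw [← phi_eq hNm hNe] at he
    obtain ⟨htr, hphi⟩ := phi_mul_eq_of_trace_ge hpos hQ he.ge
    obtain ⟨u, α, hu, hα, rfl⟩ := exists_dirCov_eq hQ.1 hphi
    rw [← quadForm_eq_curvature hNm hNe]
    refine minWeightsBases_le hNm hNe hpos hu ⟨hα, ?_⟩
    rw [← trace_dirCov hu.1, htr]

theorem minWeights_eq_minWeightsBases (hT : 0 < nT) (hNm : 0 < Nm) (hNe : 0 < Ne)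
    (hpos : 0 < lambdaMax Nm Ne Hm He)
    {u : Fin (multiplicity Nm Ne Hm He) → EuclideanSpace ℂ (Fin nT)}
    (hu : IsMaxEigenbasis Nm Ne Hm He u)
    (hd : ∀ i j, i ≠ j → gramForm Hm (u j) (u i) = 0) :
    minWeights Nm Ne Hm He u = minWeightsBases Nm Ne Hm He := by
  have hne := stdSimplex_nonempty (Nm := Nm) (Ne := Ne) (Hm := Hm) (He := He) hT
  apply le_antisymm
  · obtain ⟨α, hα⟩ := hne
    refine le_csInf ⟨_, u, hu, α, hα, rfl⟩ ?_
    rintro x ⟨v, hv, β, hβ, rfl⟩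
    obtain ⟨γ, hγ, hle⟩ := exists_quadForm_le_curvature hNm hNe hpos hu hd
      (posSemidef_dirCov v hβ.1) (by rw [trace_dirCov hv.1, hβ.2]) (phi_mul_dirCov hv β)
    rw [← quadForm_eq_curvature hNm hNe] at hle
    -- The infimum over all bases serves as the lower bound that `csInf_le` requires.
    refine le_trans (csInf_le ⟨minWeightsBases Nm Ne Hm He, ?_⟩ ⟨γ, hγ, rfl⟩) hle
    rintro _ ⟨δ, hδ, rfl⟩
    exact minWeightsBases_le hNm hNe hpos hu hδ
  · refine le_csInf (hne.image _) ?_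
    rintro _ ⟨α, hα, rfl⟩
    exact minWeightsBases_le hNm hNe hpos hu hα

theorem maxRate_eq_gain (hNm : 0 < Nm) (hNe : 0 < Ne) (t : ℝ) :
    maxRate Nm Ne Hm He (Nm * t) = gain Hm (scaledEve Nm Ne He) t := by
  have key : ∀ K : Matrix (Fin nT) (Fin nT) ℂ,
      rate Nm Ne Hm He K = nrate Hm (scaledEve Nm Ne He) (Nm⁻¹ • K) := by
    intro K
    have h1 : ((1 / Nm : ℝ) : ℂ) • (Hm * K * Hmᴴ) = Hm * (Nm⁻¹ • K) * Hmᴴ := by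
      rw [Matrix.mul_smul, Matrix.smul_mul, one_div]; rfl
    have h2 : ((1 / Ne : ℝ) : ℂ) • (He * K * Heᴴ) =
        scaledEve Nm Ne He * (Nm⁻¹ • K) * (scaledEve Nm Ne He)ᴴ := by
      rw [conjTranspose_scaledEve, scaledEve]
      simp only [Matrix.mul_smul, Matrix.smul_mul, smul_smul]
      have : √(Nm / Ne) * (√(Nm / Ne) * Nm⁻¹) = 1 / Ne := by
        rw [← mul_assoc, Real.mul_self_sqrt (by positivity)]; field_simp
      have h3 : √(Nm / Ne) * (Nm⁻¹ * √(Nm / Ne)) = 1 / Ne := by rw [← this]; ring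
      rw [h3]; rfl
    rw [rate, nrate, logDet, logDet, h1, h2]
  rw [maxRate, gain]
  congr 1
  ext x
  constructor
  · rintro ⟨K, ⟨hK, htr⟩, rfl⟩
    refine ⟨Nm⁻¹ • K, ⟨hK.smul (by positivity), ?_⟩, (key K).symm⟩
    rw [trace_smul, Complex.smul_re, smul_eq_mul, inv_mul_le_iff₀ hNm]
    exact htr
  · rintro ⟨K, ⟨hK, htr⟩, rfl⟩
    refine ⟨Nm • K, ⟨hK.smul hNm.le, ?_⟩, ?_⟩
    · rw [trace_smul, Complex.smul_re, smul_eq_mul]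
      exact mul_le_mul_of_nonneg_left htr hNm.le
    · rw [key, inv_smul_smul₀ hNm.ne']

theorem capacity_eq (hNm : 0 < Nm) (hNe : 0 < Ne) (s : ℝ) :
    capacity Nm Ne Hm He s = (1 / (nR : ℝ)) * gain Hm (scaledEve Nm Ne He) (nR * s) := by
  rw [capacity, ← maxRate_eq_gain hNm hNe]
  congr 2; ring

theorem monotoneOn_gain {n m p : Type*} [Fintype n] [DecidableEq n] [Fintype m] [DecidableEq m]
    [Fintype p] [DecidableEq p] (H : Matrix m n ℂ) (G : Matrix p n ℂ) :
    MonotoneOn (gain H G) (Set.Ici 0) := by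
  intro s hs t _ hst
  obtain ⟨K, hK, e⟩ := exists_nrate_eq_gain H G hs
  rw [← e]
  exact nrate_le_gain H G ⟨hK.1, hK.2.trans hst⟩

/-- The second-order coefficient of the gain. -/
def minCurvature (Nm Ne : ℝ) (Hm : Matrix (Fin nR) (Fin nT) ℂ)
    (He : Matrix (Fin nE) (Fin nT) ℂ) : ℝ :=
  if 0 < lambdaMax Nm Ne Hm He then minWeightsBases Nm Ne Hm He else 0

theorem gain_le_max_mul (hNm : 0 < Nm) (hNe : 0 < Ne) {t : ℝ} (ht : 0 ≤ t) :
    gain Hm (scaledEve Nm Ne He) t ≤ max (lambdaMax Nm Ne Hm He) 0 * t := by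
  refine gain_le_mul (le_max_right _ _) ?_ ht
  rw [← phi_eq hNm hNe]
  exact posSemidef_smul_one_sub_phi (le_max_left _ _)

theorem gain_lower (hT : 0 < nT) (hNm : 0 < Nm) (hNe : 0 < Ne) {t : ℝ} (ht : 0 ≤ t) :
    max (lambdaMax Nm Ne Hm He) 0 * t - minCurvature Nm Ne Hm He * t ^ 2 / 2 ≤
      gain Hm (scaledEve Nm Ne He) t := by
  rw [minCurvature]
  split_ifs with h
  · rw [max_eq_left h.le]
    exact minWeightsBases_lower hT hNm hNe h ht
  · rw [max_eq_right (not_lt.1 h)]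
    simpa using gain_nonneg _ _ ht

theorem gain_upper (hNm : 0 < Nm) (hNe : 0 < Ne) {ε : ℝ} (hε : 0 < ε) :
    ∀ᶠ t in 𝓝[>] (0:ℝ), gain Hm (scaledEve Nm Ne He) t ≤
      max (lambdaMax Nm Ne Hm He) 0 * t - (minCurvature Nm Ne Hm He - ε) * t ^ 2 / 2 := by
  rw [minCurvature]
  split_ifs with h
  · rw [max_eq_left h.le]
    exact minWeightsBases_upper hNm hNe h hε
  · filter_upwards [self_mem_nhdsWithin] with t ht
    have h1 := gain_le_max_mul (Hm := Hm) (He := He) hNm hNe (le_of_lt ht)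
    have : 0 ≤ ε * t ^ 2 / 2 := by positivity
    linarith

/-- The capacity is g(nR s)/nR, so the slope is unchanged and the quadratic coefficient acquires the
factor nR. -/
theorem isGain_capacity (hT : 0 < nT) (hR : 0 < nR) (hNm : 0 < Nm) (hNe : 0 < Ne) :
    IsGain (capacity Nm Ne Hm He) (max (lambdaMax Nm Ne Hm He) 0)
      (nR * minCurvature Nm Ne Hm He) := by
  have : Nonempty (Fin nT) := ⟨⟨0, hT⟩⟩
  have hR' : (0 : ℝ) < nR := by exact_mod_cast hR
  have e : capacity Nm Ne Hm He =
      fun s => (1 / (nR : ℝ)) * gain Hm (scaledEve Nm Ne He) (nR * s) :=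
    funext fun s => capacity_eq hNm hNe s
  have hscale : ∀ s : ℝ, 0 ≤ s → 0 ≤ (nR : ℝ) * s := fun s hs => by positivity
  rw [e]
  constructor
  · refine ⟨convex_Ici 0, fun x hx y hy a b ha hb hab => ?_⟩
    have h1 := (concaveOn_gain Hm (scaledEve Nm Ne He)).2 (hscale x hx) (hscale y hy) ha hb hab
    simp only [smul_eq_mul] at h1 ⊢
    have h2 := mul_le_mul_of_nonneg_left h1 (show 0 ≤ 1 / (nR : ℝ) by positivity)
    have h3 : (nR : ℝ) * (a * x + b * y) = a * (nR * x) + b * (nR * y) := by ring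
    rw [h3]
    linarith
  · intro x hx y hy hxy
    refine mul_le_mul_of_nonneg_left ?_ (by positivity)
    exact monotoneOn_gain _ _ (hscale x hx) (hscale y hy) (mul_le_mul_of_nonneg_left hxy hR'.le)
  · simp [gain_zero]
  · intro t ht
    have := mul_le_mul_of_nonneg_left (gain_le_max_mul (Hm := Hm) (He := He) hNm hNe (hscale t ht))
      (show 0 ≤ 1 / (nR : ℝ) by positivity)
    refine this.trans (le_of_eq ?_)
    field_simp
  · intro t ht
    have := mul_le_mul_of_nonneg_left (gain_lower (Hm := Hm) (He := He) hT hNm hNe (hscale t ht))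
      (show 0 ≤ 1 / (nR : ℝ) by positivity)
    refine le_trans (le_of_eq ?_) this
    field_simp
  · intro t ht
    have h1 := differentiableAt_gain Hm (scaledEve Nm Ne He) (mul_pos hR' ht)
    have h2 : DifferentiableAt ℝ (fun s : ℝ => (nR : ℝ) * s) t := by fun_prop
    exact (DifferentiableAt.comp (f := fun s : ℝ => (nR : ℝ) * s) t h1 h2).const_mul _

theorem capacity_upper (hR : 0 < nR) (hNm : 0 < Nm) (hNe : 0 < Ne) {ε : ℝ} (hε : 0 < ε) :
    ∀ᶠ t in 𝓝[>] (0:ℝ), capacity Nm Ne Hm He t ≤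
      max (lambdaMax Nm Ne Hm He) 0 * t - (nR * minCurvature Nm Ne Hm He - ε) * t ^ 2 / 2 := by
  have hR' : (0 : ℝ) < nR := by exact_mod_cast hR
  have hlim : Tendsto (fun s : ℝ => (nR : ℝ) * s) (𝓝[>] 0) (𝓝[>] 0) := by
    refine tendsto_nhdsWithin_iff.2 ⟨?_, ?_⟩
    · have : Continuous (fun s : ℝ => (nR : ℝ) * s) := by fun_prop
      have := this.tendsto 0
      rw [mul_zero] at this
      exact this.mono_left nhdsWithin_le_nhds
    · filter_upwards [self_mem_nhdsWithin] with s hs using mul_pos hR' hs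
  filter_upwards [hlim.eventually
    (gain_upper (Hm := Hm) (He := He) hNm hNe (div_pos hε hR'))] with t ht
  rw [capacity_eq hNm hNe]
  have := mul_le_mul_of_nonneg_left ht (show 0 ≤ 1 / (nR : ℝ) by positivity)
  refine this.trans (le_of_eq ?_)
  field_simp

end Pointwise

/-! ### Measurability of the capacity -/

section Measurability

variable {nT nR nE : ℕ}

theorem continuous_logDet_conj {m n : Type*} [Fintype m] [DecidableEq m] [Fintype n]
    [DecidableEq n] {K : Matrix n n ℂ} (hK : K.PosSemidef) :
    Continuous fun V : Matrix m n ℂ => logDet (1 + V * K * Vᴴ) :=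
  Continuous.log (Complex.continuous_re.comp (Continuous.matrix_det (by fun_prop)))
    fun V => (det_re_pos (posDef_one_add_conj V hK)).ne'

/-- The feasible set does not depend on the channel, so the gain is a supremum of continuous
functions of (H, G). This avoids a measurable choice of maximizers. -/
theorem lowerSemicontinuous_gain {m n p : Type*} [Fintype m] [DecidableEq m] [Fintype n]
    [DecidableEq n] [Fintype p] [DecidableEq p] (t : ℝ) :
    LowerSemicontinuous fun x : Matrix m n ℂ × Matrix p n ℂ => gain x.1 x.2 t := by
  simp only [gain, sSup_image']
  refine lowerSemicontinuous_ciSup (fun x => ?_) fun K => ?_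
  · have := bddAbove_nrate x.1 x.2 t
    rwa [Set.image_eq_range] at this
  · exact (((continuous_logDet_conj K.2.1).comp continuous_fst).sub
      ((continuous_logDet_conj K.2.1).comp continuous_snd)).lowerSemicontinuous

theorem measurable_capacity {Ω : Type*} [MeasurableSpace Ω] {Nm Ne : ℝ} (hNm : 0 < Nm)
    (hNe : 0 < Ne) {Hm : Ω → Matrix (Fin nR) (Fin nT) ℂ} {He : Ω → Matrix (Fin nE) (Fin nT) ℂ}
    (hHm : ∀ i j, Measurable fun ω => Hm ω i j) (hHe : ∀ i j, Measurable fun ω => He ω i j)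
    (s : ℝ) : Measurable fun ω => capacity Nm Ne (Hm ω) (He ω) s := by
  have h2 : LowerSemicontinuous fun x : (Fin nR → Fin nT → ℂ) × (Fin nE → Fin nT → ℂ) =>
      gain (of x.1) (of x.2) (nR * s) := fun x y hy => by
    have hc : Continuous fun x : (Fin nR → Fin nT → ℂ) × (Fin nE → Fin nT → ℂ) =>
        ((of x.1, of x.2) : Matrix (Fin nR) (Fin nT) ℂ × Matrix (Fin nE) (Fin nT) ℂ) :=
      continuous_fst.prodMk continuous_snd
    exact hc.continuousAt.eventually (lowerSemicontinuous_gain (nR * s) (of x.1, of x.2) y hy)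
  have h3 := h2.measurable
  have h4 : Measurable fun ω => fun i j => Hm ω i j :=
    measurable_pi_iff.2 fun i => measurable_pi_iff.2 fun j => hHm i j
  have h5 : Measurable fun ω => fun i j => scaledEve Nm Ne (He ω) i j :=
    measurable_pi_iff.2 fun i => measurable_pi_iff.2 fun j =>
      (hHe i j).const_smul (Real.sqrt (Nm / Ne))
  have h6 := h3.comp (h4.prodMk h5)
  have h7 : (fun ω => capacity Nm Ne (Hm ω) (He ω) s) = fun ω => (1 / (nR : ℝ)) *
      gain (of fun i j => Hm ω i j) (of fun i j => scaledEve Nm Ne (He ω) i j) (nR * s) :=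
    funext fun ω => capacity_eq hNm hNe s
  rw [h7]
  exact h6.const_mul _

end Measurability

end SecrecyCapacity

end

/-! ### Derivatives of the average capacity -/

theorem corollary2 {nT nR nE : ℕ} (hT : 0 < nT) (hR : 0 < nR)
    {Ω : Type*} [MeasurableSpace Ω] (μ : MeasureTheory.Measure Ω)
    [MeasureTheory.IsProbabilityMeasure μ]
    (Nm Ne : ℝ) (hNm : 0 < Nm) (hNe : 0 < Ne)
    (Hm : Ω → Matrix (Fin nR) (Fin nT) ℂ) (He : Ω → Matrix (Fin nE) (Fin nT) ℂ)
    (hHm : ∀ i j, Measurable fun ω => Hm ω i j) (hHe : ∀ i j, Measurable fun ω => He ω i j)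
    -- the expectation in the formula for the first derivative exists
    (h1 : MeasureTheory.Integrable
      (fun ω => max (SecrecyCapacity.lambdaMax Nm Ne (Hm ω) (He ω)) 0) μ) :
    -- the expectation that defines the average secrecy capacity exists
    (∀ snr : ℝ, 0 ≤ snr →
      MeasureTheory.Integrable
        (fun ω => SecrecyCapacity.capacity Nm Ne (Hm ω) (He ω) snr) μ) ∧
    -- first derivative
    HasDerivWithinAt (SecrecyCapacity.avgCapacity μ Nm Ne Hm He)
      (∫ ω, max (SecrecyCapacity.lambdaMax Nm Ne (Hm ω) (He ω)) 0 ∂μ) (Set.Ici 0) 0 ∧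
    -- second derivative, if the expectation in its formula exists
    (MeasureTheory.Integrable
        (fun ω => Set.indicator {ω | 0 < SecrecyCapacity.lambdaMax Nm Ne (Hm ω) (He ω)}
          (fun ω => SecrecyCapacity.minWeightsBases Nm Ne (Hm ω) (He ω)) ω) μ →
      SecrecyCapacity.HasSecondDerivWithinAt (SecrecyCapacity.avgCapacity μ Nm Ne Hm He)
        (-(nR : ℝ) *
          ∫ ω, Set.indicator {ω | 0 < SecrecyCapacity.lambdaMax Nm Ne (Hm ω) (He ω)}
            (fun ω => SecrecyCapacity.minWeightsBases Nm Ne (Hm ω) (He ω)) ω ∂μ)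
        (Set.Ici 0) 0 ∧
      -- the minimum over the weights alone, for eigenbases in which the form of `Hm† Hm`
      -- is diagonal (every eigenbasis is one if the multiplicity is one)
      ∀ u : (ω : Ω) → Fin (SecrecyCapacity.multiplicity Nm Ne (Hm ω) (He ω)) →
          EuclideanSpace ℂ (Fin nT),
        (∀ ω, 0 < SecrecyCapacity.lambdaMax Nm Ne (Hm ω) (He ω) →
          SecrecyCapacity.IsMaxEigenbasis Nm Ne (Hm ω) (He ω) (u ω) ∧
          ∀ i j, i ≠ j → SecrecyCapacity.gramForm (Hm ω) (u ω j) (u ω i) = 0) →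
        SecrecyCapacity.HasSecondDerivWithinAt (SecrecyCapacity.avgCapacity μ Nm Ne Hm He)
          (-(nR : ℝ) *
            ∫ ω, Set.indicator {ω | 0 < SecrecyCapacity.lambdaMax Nm Ne (Hm ω) (He ω)}
              (fun ω => SecrecyCapacity.minWeights Nm Ne (Hm ω) (He ω) (u ω)) ω ∂μ)
          (Set.Ici 0) 0) := by
  have hgain := fun ω => SecrecyCapacity.isGain_capacity (Hm := Hm ω) (He := He ω) hT hR hNm hNe
  have hmeas : ∀ t : ℝ, 0 ≤ t → MeasureTheory.AEStronglyMeasurable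
      (fun ω => SecrecyCapacity.capacity Nm Ne (Hm ω) (He ω) t) μ := fun t _ =>
    (SecrecyCapacity.measurable_capacity hNm hNe hHm hHe t).aestronglyMeasurable
  refine ⟨fun s hs => SecrecyCapacity.integrable_gain hgain h1 hmeas hs,
    SecrecyCapacity.hasDerivWithinAt_integral_gain_zero hgain h1 hmeas, fun h2 => ?_⟩
  have hind : (fun ω => Set.indicator {ω | 0 < SecrecyCapacity.lambdaMax Nm Ne (Hm ω) (He ω)}
      (fun ω => SecrecyCapacity.minWeightsBases Nm Ne (Hm ω) (He ω)) ω) =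
      fun ω => SecrecyCapacity.minCurvature Nm Ne (Hm ω) (He ω) := by
    funext ω
    simp [Set.indicator, SecrecyCapacity.minCurvature]
  have hsecond : SecrecyCapacity.HasSecondDerivWithinAt
      (SecrecyCapacity.avgCapacity μ Nm Ne Hm He)
      (-(nR : ℝ) * ∫ ω, SecrecyCapacity.minCurvature Nm Ne (Hm ω) (He ω) ∂μ) (Set.Ici 0) 0 := by
    rw [neg_mul, ← MeasureTheory.integral_const_mul]
    exact SecrecyCapacity.hasSecondDerivWithinAt_integral_gain hgain h1 hmeas
      (fun ω ε hε => SecrecyCapacity.capacity_upper hR hNm hNe hε)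
      ((hind ▸ h2).const_mul (nR : ℝ))
  refine ⟨by rw [hind]; exact hsecond, fun u hu => ?_⟩
  have hindu : (fun ω => Set.indicator {ω | 0 < SecrecyCapacity.lambdaMax Nm Ne (Hm ω) (He ω)}
      (fun ω => SecrecyCapacity.minWeights Nm Ne (Hm ω) (He ω) (u ω)) ω) =
      fun ω => SecrecyCapacity.minCurvature Nm Ne (Hm ω) (He ω) := by
    funext ω
    by_cases hω : 0 < SecrecyCapacity.lambdaMax Nm Ne (Hm ω) (He ω)
    · simp [Set.indicator, SecrecyCapacity.minCurvature, hω,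
        SecrecyCapacity.minWeights_eq_minWeightsBases hT hNm hNe hω (hu ω hω).1 (hu ω hω).2]
    · simp [Set.indicator, SecrecyCapacity.minCurvature, hω]
  rw [hindu]
  exact hsecond
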